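/- **Theorem (planar Max-Weight Rectangle hardness).** Let $\varepsilon>0$ be a constant. If there is an algorithm that solves Max-Weight Rectangle on $N$ weighted points in the plane in time $O(N^{2-\varepsilon})$, then there is an algorithm that solves Max-Weight $\lceil 4/\varepsilon\rceil$-Clique on weighted graphs with $n$ vertices in time $O(n^{\lceil 4/\varepsilon\rceil-\varepsilon})$. *Problems.* Max-Weight Rectangle in the plane: given $N$ points of $\mathbb{R}^2$ (not necessarily distinct) with arbitrary real weights, output a closed axis-parallel box $[a,b]\times[c,d]$ with $a\le b$, $c\le d$ for which the total weight of the points it contains is maximum. Max-Weight $k$-Clique, for a fixed integer $k$: given a complete graph on $n\ge k$ vertices with arbitrary real edge weights (as a weighted adjacency matrix), output the maximum total edge weight of a $k$-clique. *Model.* An algorithm is a deterministic real RAM program. It has index registers holding natural numbers, real registers, and finitely many unbounded zero-initialised arrays of either kind, addressed through index registers. Each of the following costs one step: loading or storing an array cell, setting an integer constant, addition or truncated subtraction of indices, exact $+,-,\cdot,/$ on reals, converting an index to a real, comparing two index registers or two real registers. There is no conversion from reals to indices. Running time $O(f(n))$ means that for some $T:\mathbb{N}\to\mathbb{N}$ with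 $T(n)=O(f(n))$ as $n\to\infty$, the program halts with a correct output within $T(n)$ steps on every input of size $n$, where the size is the number of points or of vertices. -/

import Mathlib

open Filter Asymptotics

/-! ## The real RAM

A real RAM has index registers (natural numbers), real registers, and finitely many unbounded
arrays of either kind with indirect addressing. A program is a finite text that names only
finitely many registers and arrays. It is written in structured form (sequence, branch, loop).
Every elementary instruction and every evaluation of a test costs one step. Exact real arithmetic
`+, -, *, /` and comparison are available; there is no rounding of a real to an integer, and the
only real constants in a program are integers. Index arithmetic is addition and
(truncated) subtraction. -/

namespace RealRAM

/-- Memory contents: registers and array cells are addressed by natural numbers. -/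
structure State where
  /-- index registers -/
  ireg : ℕ → ℕ
  /-- real registers -/
  rreg : ℕ → ℝ
  /-- `iarr A i` is cell `i` of the index array `A` -/
  iarr : ℕ → ℕ → ℕ
  /-- `rarr A i` is cell `i` of the real array `A` -/
  rarr : ℕ → ℕ → ℝ

/-- Elementary instructions. The arguments are the literal names of registers (`r`, `a`, `b`, `i`)
and arrays (`A`), except that `c` is a literal constant. -/
inductive Instr where
  | iconst (r c : ℕ)
  | iadd (r a b : ℕ)
  | isub (r a b : ℕ)
  | iload (r A i : ℕ)
  | istore (A i a : ℕ)
  | rconst (r : ℕ) (c : ℤ)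
  | rcast (r a : ℕ)
  | radd (r a b : ℕ)
  | rsub (r a b : ℕ)
  | rmul (r a b : ℕ)
  | rdiv (r a b : ℕ)
  | rload (r A i : ℕ)
  | rstore (A i a : ℕ)

/-- Overwrite the index register `r`. -/
def State.setI (s : State) (r v : ℕ) : State :=
  { s with ireg := Function.update s.ireg r v }

/-- Overwrite the real register `r`. -/
def State.setR (s : State) (r : ℕ) (v : ℝ) : State :=
  { s with rreg := Function.update s.rreg r v }

/-- Overwrite cell `i` of the index array `A`. -/
def State.setIArr (s : State) (A i v : ℕ) : State :=
  { s with iarr := Function.update s.iarr A (Function.update (s.iarr A) i v) }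

/-- Overwrite cell `i` of the real array `A`. -/
def State.setRArr (s : State) (A i : ℕ) (v : ℝ) : State :=
  { s with rarr := Function.update s.rarr A (Function.update (s.rarr A) i v) }

/-- The effect of an elementary instruction. Array cells are addressed through the current content
of an index register. -/
noncomputable def Instr.apply : Instr → State → State
  | iconst r c, s => s.setI r c
  | iadd r a b, s => s.setI r (s.ireg a + s.ireg b)
  | isub r a b, s => s.setI r (s.ireg a - s.ireg b)
  | iload r A i, s => s.setI r (s.iarr A (s.ireg i))
  | istore A i a, s => s.setIArr A (s.ireg i) (s.ireg a)
  | rconst r c, s => s.setR r (c : ℝ)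
  | rcast r a, s => s.setR r (s.ireg a : ℝ)
  | radd r a b, s => s.setR r (s.rreg a + s.rreg b)
  | rsub r a b, s => s.setR r (s.rreg a - s.rreg b)
  | rmul r a b, s => s.setR r (s.rreg a * s.rreg b)
  | rdiv r a b, s => s.setR r (s.rreg a / s.rreg b)
  | rload r A i, s => s.setR r (s.rarr A (s.ireg i))
  | rstore A i a, s => s.setRArr A (s.ireg i) (s.rreg a)

/-- Tests: strict comparison of two index registers or of two real registers. -/
inductive Test where
  | ilt (a b : ℕ)
  | rlt (a b : ℕ)

/-- The test succeeds in the given state. -/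
def Test.Holds : Test → State → Prop
  | ilt a b, s => s.ireg a < s.ireg b
  | rlt a b, s => s.rreg a < s.rreg b

/-- Programs. -/
inductive Prog where
  | skip
  | instr (e : Instr)
  | seq (p q : Prog)
  | branch (c : Test) (p q : Prog)
  | loop (c : Test) (p : Prog)

/-- `Exec p s t s'`: started in state `s`, the program `p` halts in state `s'` after exactly `t`
steps. (A program that does not halt from `s` has no such `t` and `s'`.) -/
inductive Exec : Prog → State → ℕ → State → Prop
  | skip (s : State) : Exec .skip s 1 s
  | instr (e : Instr) (s : State) : Exec (.instr e) s 1 (e.apply s)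
  | seq {p q : Prog} {s s₁ s₂ : State} {t₁ t₂ : ℕ} :
      Exec p s t₁ s₁ → Exec q s₁ t₂ s₂ → Exec (.seq p q) s (t₁ + t₂) s₂
  | branchTrue {c : Test} {p q : Prog} {s s₁ : State} {t : ℕ} :
      c.Holds s → Exec p s t s₁ → Exec (.branch c p q) s (1 + t) s₁
  | branchFalse {c : Test} {p q : Prog} {s s₁ : State} {t : ℕ} :
      ¬ c.Holds s → Exec q s t s₁ → Exec (.branch c p q) s (1 + t) s₁
  | loopTrue {c : Test} {p : Prog} {s s₁ s₂ : State} {t₁ t₂ : ℕ} :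
      c.Holds s → Exec p s t₁ s₁ → Exec (.loop c p) s₁ t₂ s₂ →
      Exec (.loop c p) s (1 + t₁ + t₂) s₂
  | loopFalse {c : Test} {p : Prog} {s : State} :
      ¬ c.Holds s → Exec (.loop c p) s 1 s

end RealRAM

/-! ## Max-Weight Rectangle in the plane -/

section Rectangle

variable {N : ℕ}

open Classical in
/-- Total weight of the points in the closed axis-parallel box with lower left corner `lo` and
upper right corner `hi` (`ℝ × ℝ` has the coordinatewise order). -/
noncomputable def boxWeight (pts : Fin N → ℝ × ℝ) (wt : Fin N → ℝ) (lo hi : ℝ × ℝ) : ℝ :=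
  ∑ i with pts i ∈ Set.Icc lo hi, wt i

/-- The box with corners `lo ≤ hi` has the largest total weight among all axis-parallel boxes. -/
def IsMaxWeightBox (pts : Fin N → ℝ × ℝ) (wt : Fin N → ℝ) (lo hi : ℝ × ℝ) : Prop :=
  lo ≤ hi ∧ ∀ lo' hi' : ℝ × ℝ, lo' ≤ hi' → boxWeight pts wt lo' hi' ≤ boxWeight pts wt lo hi

/-- Input of Max-Weight Rectangle: `N` in index register `0`, the two coordinates and the weight
of the `i`-th point in cell `i` of the real arrays `0`, `1`, `2`, and zero elsewhere. -/
noncomputable def rectangleInput (pts : Fin N → ℝ × ℝ) (wt : Fin N → ℝ) : RealRAM.State where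
  ireg r := if r = 0 then N else 0
  rreg _ := 0
  iarr _ _ := 0
  rarr A i :=
    if h : i < N then
      if A = 0 then (pts ⟨i, h⟩).1
      else if A = 1 then (pts ⟨i, h⟩).2
      else if A = 2 then wt ⟨i, h⟩
      else 0
    else 0

end Rectangle

/-- `P` solves Max-Weight Rectangle in the plane with running time `T`: on all `N` points (not
necessarily distinct) with real coordinates and weights, it halts within `T N` steps with the
corners `(R₀, R₁) ≤ (R₂, R₃)` of a box of maximum weight in the real registers `0` to `3`. -/
def SolvesMaxWeightRectangle (P : RealRAM.Prog) (T : ℕ → ℕ) : Prop :=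
  ∀ (N : ℕ) (pts : Fin N → ℝ × ℝ) (wt : Fin N → ℝ), ∃ (t : ℕ) (s : RealRAM.State),
    RealRAM.Exec P (rectangleInput pts wt) t s ∧ t ≤ T N ∧
    IsMaxWeightBox pts wt (s.rreg 0, s.rreg 1) (s.rreg 2, s.rreg 3)

/-! ## Max-Weight `k`-Clique -/

section Clique

variable {n : ℕ}

/-- Total weight of the edges inside the vertex set `S`, each edge counted once. -/
def cliqueWeight (w : Fin n → Fin n → ℝ) (S : Finset (Fin n)) : ℝ :=
  ∑ i ∈ S, ∑ j ∈ S with i < j, w i j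

/-- Input of Max-Weight `k`-Clique: `n` in index register `0`, the weighted adjacency matrix
row by row (`w i j` in cell `i * n + j`) in real array `0`, and zero elsewhere. -/
noncomputable def cliqueInput (w : Fin n → Fin n → ℝ) : RealRAM.State where
  ireg r := if r = 0 then n else 0
  rreg _ := 0
  iarr _ _ := 0
  rarr A m :=
    if h : A = 0 ∧ m < n * n then
      w ⟨m / n, Nat.div_lt_of_lt_mul h.2⟩
        ⟨m % n, Nat.mod_lt m (Nat.pos_of_mul_pos_left (Nat.zero_lt_of_lt h.2))⟩
    else 0

end Clique

/-- `Q` solves Max-Weight `k`-Clique with running time `T`: on every complete graph with `n ≥ k`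
vertices and real edge weights `w i j = w j i` (the diagonal is irrelevant), it halts within `T n`
steps with the maximum total edge weight of a `k`-clique in the real register `0`. -/
def SolvesMaxWeightClique (k : ℕ) (Q : RealRAM.Prog) (T : ℕ → ℕ) : Prop :=
  ∀ (n : ℕ) (w : Fin n → Fin n → ℝ), k ≤ n → (∀ i j, w i j = w j i) →
    ∃ (t : ℕ) (s : RealRAM.State),
      RealRAM.Exec Q (cliqueInput w) t s ∧ t ≤ T n ∧
      IsGreatest (cliqueWeight w '' {S | (⊤ : SimpleGraph (Fin n)).IsNClique k S}) (s.rreg 0)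

/-! A `k`-tuple of vertices `z 0, ..., z (k-1)`, read as digits in base `n`, is written into the
four sides of a box around the origin. On each axis the digits with even index are the expansion of
the extent in the negative direction, those with odd index of the extent in the positive direction.
The first axis lists them by increasing index (digit `a` at depth `a / 2 + 1`), the second by
decreasing index (digit `b` at depth `(k + 1 - b) / 2`). So each digit is written twice, and for `a
< b` the first-axis prefix ending in digit `a` and the second-axis prefix ending in digit `b` have
total length at most `k / 2 + 1`.

Four points with signs `+, -, -, +` at the corners of a grid cell contribute to such a box only if
its corner in that quadrant lies in the cell (`boxSum_quad`). One such quadruple for every pair of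
prefixes lets a gadget add any function of the two prefixes to the weight of the box. For `a < b`
the gadget adds `w (z a) (z b)`, or `-M` if the two vertices coincide. For `a = b` it adds `M` if
the two copies of the digit agree; prefix pairs with different last digits are left out, which saves
one digit. All in all there are `O(n ^ (k / 2 + 1))` points (`fstDepth_add_innerDepth_le`,
`numPoints_le`).

Let `B` bound the entries and `M = 2 k² B + 1`. A box around the origin weighs either `k M` plus the
weight of a clique, or at most `k M - M + k² B`, which is less than `k M - k² B`
(`clique_or_boxSum_le`). Every clique occurs (`exists_box_of_clique`), and a very heavy point at the
origin forces the optimal box to contain it. Hence the optimum reveals the heaviest clique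
(`isGreatest_of_isMax`).

With `N = O(n ^ (k / 2 + 1))` the time `N ^ (2 - ε)` is `O(n ^ (k - ε))`, since `(k / 2 + 1) (2 - ε)
≤ k - ε` amounts to `k ε ≥ 4`. The overhead of the reduction fits as well if `ε ≤ 1`, and larger `ε`
are impossible because every weight has to be read (`SolvesMaxWeightRectangle.le_time`). The rest is
a verification of the RAM program, with the invariant `Building` for the memory. -/

namespace RealRAM

/-! ### A linear lower bound for Max-Weight Rectangle -/

theorem State.setRArr_comm (s : State) (A i B j : ℕ) (x y : ℝ) (h : i ≠ j) :
    (s.setRArr A i x).setRArr B j y = (s.setRArr B j y).setRArr A i x := by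
  simp only [State.setRArr, State.mk.injEq, true_and]
  by_cases hAB : A = B
  · subst hAB
    simp [Function.update_comm h]
  · rw [Function.update_comm hAB]
    simp [Function.update_of_ne hAB, Function.update_of_ne (Ne.symm hAB)]

/-- One instruction touches at most one cell of a given real array. -/
theorem Instr.apply_setRArr (e : Instr) (s : State) (A : ℕ) : ∃ c : ℕ, ∀ i ≠ c, ∀ x : ℝ,
    e.apply (s.setRArr A i x) = (e.apply s).setRArr A i x := by
  cases e with
  | rload r B j =>
    refine ⟨s.ireg j, fun i hi x => ?_⟩
    have : (s.setRArr A i x).rarr B ((s.setRArr A i x).ireg j) = s.rarr B (s.ireg j) := by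
      simp only [State.setRArr, Function.update_apply]
      split_ifs with h1
      · simp [Function.update_of_ne (Ne.symm hi), h1]
      · rfl
    simp only [Instr.apply, this]
    rfl
  | rstore B j a =>
    exact ⟨s.ireg j, fun i hi x => State.setRArr_comm s A i B (s.ireg j) x (s.rreg a) hi⟩
  | _ => exact ⟨0, fun i hi x => rfl⟩

/-- A run of `t` steps depends on at most `t` cells of a given real array. -/
theorem Exec.exists_untouched {p : Prog} {s s' : State} {t : ℕ} (h : Exec p s t s') (A : ℕ) :
    ∃ F : Finset ℕ, F.card ≤ t ∧ ∀ i ∉ F, ∀ x : ℝ,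
      Exec p (s.setRArr A i x) t (s'.setRArr A i x) := by
  induction h with
  | skip s => exact ⟨∅, by simp, fun i _ x => .skip _⟩
  | instr e s =>
    obtain ⟨c, hc⟩ := e.apply_setRArr s A
    refine ⟨{c}, by simp, fun i hi x => ?_⟩
    rw [← hc i (by simpa using hi) x]
    exact .instr _ _
  | seq _ _ ih₁ ih₂ =>
    obtain ⟨F, hF, h1⟩ := ih₁
    obtain ⟨G, hG, h2⟩ := ih₂
    refine ⟨F ∪ G, (Finset.card_union_le _ _).trans (by omega), fun i hi x => ?_⟩
    rw [Finset.mem_union, not_or] at hi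
    exact .seq (h1 i hi.1 x) (h2 i hi.2 x)
  | @branchTrue c p q s s₁ t hc _ ih =>
    obtain ⟨F, hF, h1⟩ := ih
    exact ⟨F, by omega, fun i hi x => .branchTrue (by cases c <;> exact hc) (h1 i hi x)⟩
  | @branchFalse c p q s s₁ t hc _ ih =>
    obtain ⟨F, hF, h1⟩ := ih
    exact ⟨F, by omega, fun i hi x => .branchFalse (by cases c <;> exact hc) (h1 i hi x)⟩
  | @loopTrue c p s s₁ s₂ t₁ t₂ hc _ _ ih₁ ih₂ =>
    obtain ⟨F, hF, h1⟩ := ih₁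
    obtain ⟨G, hG, h2⟩ := ih₂
    refine ⟨F ∪ G, (Finset.card_union_le _ _).trans (by omega), fun i hi x => ?_⟩
    rw [Finset.mem_union, not_or] at hi
    exact .loopTrue (by cases c <;> exact hc) (h1 i hi.1 x) (h2 i hi.2 x)
  | @loopFalse c p s hc =>
    exact ⟨∅, by simp, fun i _ x => .loopFalse (by cases c <;> exact hc)⟩

/-- The specification of a solver only asserts that some run exists. Determinism identifies that run
with the one transplanted to an input changed in an untouched cell. -/
theorem Exec.det {p : Prog} {s s₁ s₂ : State} {t₁ t₂ : ℕ} (h₁ : Exec p s t₁ s₁)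
    (h₂ : Exec p s t₂ s₂) : s₁ = s₂ := by
  induction h₁ generalizing s₂ t₂ with
  | skip s => cases h₂; rfl
  | instr e s => cases h₂; rfl
  | seq _ _ ih₁ ih₂ =>
    cases h₂ with
    | seq a b => obtain rfl := ih₁ a; exact ih₂ b
  | branchTrue hc _ ih =>
    cases h₂ with
    | branchTrue _ a => exact ih a
    | branchFalse hn _ => exact absurd hc hn
  | branchFalse hc _ ih =>
    cases h₂ with
    | branchTrue hn _ => exact absurd hn hc
    | branchFalse _ a => exact ih a
  | loopTrue hc _ _ ih₁ ih₂ =>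
    cases h₂ with
    | loopTrue _ a b => obtain rfl := ih₁ a; exact ih₂ b
    | loopFalse hn => exact absurd hc hn
  | loopFalse hc =>
    cases h₂ with
    | loopTrue hn _ _ => exact absurd hn hc
    | loopFalse _ => rfl

end RealRAM

open RealRAM

/-- Max-Weight Rectangle cannot be solved without looking at every point. -/
theorem SolvesMaxWeightRectangle.le_time {P : Prog} {T : ℕ → ℕ}
    (h : SolvesMaxWeightRectangle P T) (N : ℕ) : N ≤ T N := by
  by_contra! hlt
  -- Adversary: all points sit at the origin with weight `-1`, so an optimal box avoids the origin.
  set pts : Fin N → ℝ × ℝ := fun _ => (0, 0) with hpts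
  obtain ⟨t, s, hex, ht, hle, hmax⟩ := h N pts (fun _ => -1)
  obtain ⟨F, hF, hun⟩ := hex.exists_untouched 2
  obtain ⟨i, hi⟩ : ∃ i : Fin N, (i : ℕ) ∉ F := by
    by_contra! hall
    have : ((Finset.univ : Finset (Fin N)).map Fin.valEmbedding : Finset ℕ) ⊆ F := by
      intro j hj
      obtain ⟨a, -, rfl⟩ := Finset.mem_map.1 hj
      exact hall a
    have := Finset.card_le_card this
    simp at this
    omega
  -- Raising one unread weight to `N` makes the total `N - (N - 1) = 1 > 0`: now the optimal box
  -- must contain the origin, yet the output is unchanged.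
  set wt : Fin N → ℝ := Function.update (fun _ => -1) i (N : ℝ) with hwt
  have hin : (rectangleInput pts (fun _ => -1)).setRArr 2 i (N : ℝ) = rectangleInput pts wt := by
    simp only [State.setRArr, rectangleInput, State.mk.injEq, true_and]
    funext A j
    by_cases hA : A = 2
    · subst hA
      by_cases hj : j = i
      · subst hj; simp [hwt]
      · simp only [Function.update_self, Function.update_of_ne hj]
        by_cases hjN : j < N
        · have : (⟨j, hjN⟩ : Fin N) ≠ i := fun e => hj (by rw [← e])
          simp [hjN, hwt, Function.update_of_ne this]
        · simp [hjN]
    · simp [hA]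
  have hex' := hun i hi (N : ℝ)
  rw [hin] at hex'
  obtain ⟨t', s', hex₂, -, -, hmax'⟩ := h N pts wt
  obtain rfl := hex'.det hex₂
  set lo : ℝ × ℝ := (s.rreg 0, s.rreg 1)
  set hi' : ℝ × ℝ := (s.rreg 2, s.rreg 3)
  have hbox : ∀ (v : Fin N → ℝ) (lo hi : ℝ × ℝ), boxWeight pts v lo hi =
      if (0, 0) ∈ Set.Icc lo hi then ∑ j, v j else 0 := by
    intro v lo hi
    unfold boxWeight
    rw [Finset.sum_filter]
    split_ifs with h0
    · simp
    · simp
  have hN : (1 : ℝ) ≤ N := by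
    have := i.pos
    exact_mod_cast this
  have hout : ((0, 0) : ℝ × ℝ) ∉ Set.Icc lo hi' := by
    intro hmem
    have := hmax (1, 1) (1, 1) le_rfl
    rw [hbox, hbox, if_pos hmem, if_neg (by simp)] at this
    simp at this
    linarith
  have h2 := hmax' (0, 0) (0, 0) le_rfl
  have h3 : boxWeight pts wt lo hi' = 0 := by rw [hbox, if_neg hout]
  change _ ≤ boxWeight pts wt lo hi' at h2
  rw [h3, hbox, if_pos (by simp), hwt, Finset.sum_update_of_mem (Finset.mem_univ i)] at h2
  have h4 : ((Finset.univ \ {i}).card : ℝ) = N - 1 := by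
    rw [Finset.card_sdiff]
    simp [Nat.cast_sub (Nat.one_le_of_lt i.pos)]
  simp only [Finset.sum_const, nsmul_eq_mul, h4] at h2
  linarith

namespace RealRAM

/-! ### Renaming registers and arrays -/

/-- Add `d` to the names of all registers and arrays. -/
def Instr.shift (d : ℕ) : Instr → Instr
  | iconst r c => iconst (r + d) c
  | iadd r a b => iadd (r + d) (a + d) (b + d)
  | isub r a b => isub (r + d) (a + d) (b + d)
  | iload r A i => iload (r + d) (A + d) (i + d)
  | istore A i a => istore (A + d) (i + d) (a + d)
  | rconst r c => rconst (r + d) c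
  | rcast r a => rcast (r + d) (a + d)
  | radd r a b => radd (r + d) (a + d) (b + d)
  | rsub r a b => rsub (r + d) (a + d) (b + d)
  | rmul r a b => rmul (r + d) (a + d) (b + d)
  | rdiv r a b => rdiv (r + d) (a + d) (b + d)
  | rload r A i => rload (r + d) (A + d) (i + d)
  | rstore A i a => rstore (A + d) (i + d) (a + d)

/-- Add `d` to the names of all registers. -/
def Test.shift (d : ℕ) : Test → Test
  | ilt a b => ilt (a + d) (b + d)
  | rlt a b => rlt (a + d) (b + d)

/-- Add `d` to the names of all registers and arrays. -/
def Prog.shift (d : ℕ) : Prog → Prog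
  | skip => skip
  | instr e => instr (e.shift d)
  | seq p q => seq (p.shift d) (q.shift d)
  | branch c p q => branch (c.shift d) (p.shift d) (q.shift d)
  | loop c p => loop (c.shift d) (p.shift d)

/-- The part of the memory with names at least `d`. -/
def State.high (d : ℕ) (s : State) : State where
  ireg r := s.ireg (r + d)
  rreg r := s.rreg (r + d)
  iarr A := s.iarr (A + d)
  rarr A := s.rarr (A + d)

/-- The parts of the memory with names below `d` agree. -/
structure LowEq (d : ℕ) (s s' : State) : Prop where
  ireg : ∀ r < d, s'.ireg r = s.ireg r
  rreg : ∀ r < d, s'.rreg r = s.rreg r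
  iarr : ∀ r < d, s'.iarr r = s.iarr r
  rarr : ∀ r < d, s'.rarr r = s.rarr r

theorem LowEq.refl (d : ℕ) (s : State) : LowEq d s s :=
  ⟨fun _ _ => rfl, fun _ _ => rfl, fun _ _ => rfl, fun _ _ => rfl⟩

theorem LowEq.trans {d : ℕ} {s₁ s₂ s₃ : State} (h : LowEq d s₁ s₂) (h' : LowEq d s₂ s₃) :
    LowEq d s₁ s₃ :=
  ⟨fun r hr => (h'.ireg r hr).trans (h.ireg r hr), fun r hr => (h'.rreg r hr).trans (h.rreg r hr),
    fun r hr => (h'.iarr r hr).trans (h.iarr r hr), fun r hr => (h'.rarr r hr).trans (h.rarr r hr)⟩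

theorem update_shift {α : Type*} (f : ℕ → α) (d r : ℕ) (v : α) :
    (fun x => Function.update f (r + d) v (x + d)) =
      Function.update (fun x => f (x + d)) r v := by
  funext x
  simp [Function.update_apply]

theorem Instr.shift_apply_high (e : Instr) (d : ℕ) (s : State) :
    ((e.shift d).apply s).high d = e.apply (s.high d) := by
  cases e <;>
    simp [Instr.shift, Instr.apply, State.high, State.setI, State.setR, State.setIArr,
      State.setRArr, update_shift]

theorem Instr.shift_apply_low (e : Instr) (d : ℕ) (s : State) :
    LowEq d s ((e.shift d).apply s) := by
  have key : ∀ {α : Type} (f : ℕ → α) (r x : ℕ) (v : α), x < d →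
      Function.update f (r + d) v x = f x :=
    fun f r x v hx => Function.update_of_ne (by omega) _ _
  cases e <;> refine ⟨?_, ?_, ?_, ?_⟩ <;> intro r hr <;>
    simp [Instr.shift, Instr.apply, State.setI, State.setR, State.setIArr, State.setRArr, key, hr]

theorem Test.shift_holds (c : Test) (d : ℕ) (s : State) :
    (c.shift d).Holds s ↔ c.Holds (s.high d) := by
  cases c <;> rfl

/-- A renamed program acts on the high part of the memory and leaves the low part alone. -/
theorem Exec.shift {p : Prog} {σ σ' : State} {t : ℕ} (h : Exec p σ t σ') (d : ℕ) :
    ∀ s : State, s.high d = σ →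
      ∃ s', Exec (p.shift d) s t s' ∧ s'.high d = σ' ∧ LowEq d s s' := by
  induction h with
  | skip s => exact fun s hs => ⟨s, .skip _, hs, .refl _ _⟩
  | instr e s =>
    rintro s rfl
    exact ⟨_, .instr _ _, e.shift_apply_high d s, e.shift_apply_low d s⟩
  | seq _ _ ih₁ ih₂ =>
    intro s hs
    obtain ⟨s₁, h1, h2, h3⟩ := ih₁ s hs
    obtain ⟨s₂, h4, h5, h6⟩ := ih₂ s₁ h2
    exact ⟨s₂, .seq h1 h4, h5, h3.trans h6⟩
  | branchTrue hc _ ih =>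
    rintro s rfl
    obtain ⟨s₁, h1, h2, h3⟩ := ih s rfl
    exact ⟨s₁, .branchTrue ((Test.shift_holds _ _ _).2 hc) h1, h2, h3⟩
  | branchFalse hc _ ih =>
    rintro s rfl
    obtain ⟨s₁, h1, h2, h3⟩ := ih s rfl
    exact ⟨s₁, .branchFalse (mt (Test.shift_holds _ _ _).1 hc) h1, h2, h3⟩
  | loopTrue hc _ _ ih₁ ih₂ =>
    rintro s rfl
    obtain ⟨s₁, h1, h2, h3⟩ := ih₁ s rfl
    obtain ⟨s₂, h4, h5, h6⟩ := ih₂ s₁ h2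
    exact ⟨s₂, .loopTrue ((Test.shift_holds _ _ _).2 hc) h1 h4, h5, h3.trans h6⟩
  | loopFalse hc =>
    rintro s rfl
    exact ⟨s, .loopFalse (mt (Test.shift_holds _ _ _).1 hc), rfl, .refl _ _⟩

/-! ### Total correctness with a time bound -/

/-- Started in `s`, the program `p` halts within `T` steps in a state that satisfies `Q`. -/
def Runs (p : Prog) (s : State) (T : ℕ) (Q : State → Prop) : Prop :=
  ∃ t s', Exec p s t s' ∧ t ≤ T ∧ Q s'

theorem Runs.mono {p : Prog} {s : State} {T T' : ℕ} {Q Q' : State → Prop} (h : Runs p s T Q)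
    (hT : T ≤ T') (hQ : ∀ s', Q s' → Q' s') : Runs p s T' Q' := by
  obtain ⟨t, s', h1, h2, h3⟩ := h
  exact ⟨t, s', h1, h2.trans hT, hQ _ h3⟩

theorem Runs.skip {s : State} {Q : State → Prop} (h : Q s) : Runs .skip s 1 Q :=
  ⟨1, s, .skip _, le_rfl, h⟩

theorem Runs.instr {e : Instr} {s : State} {Q : State → Prop} (h : Q (e.apply s)) :
    Runs (.instr e) s 1 Q :=
  ⟨1, _, .instr _ _, le_rfl, h⟩

theorem Runs.seq {p q : Prog} {s : State} {T₁ T₂ : ℕ} {Q R : State → Prop} (h : Runs p s T₁ R)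
    (h' : ∀ s', R s' → Runs q s' T₂ Q) : Runs (.seq p q) s (T₁ + T₂) Q := by
  obtain ⟨t, s', h1, h2, h3⟩ := h
  obtain ⟨t', s'', h4, h5, h6⟩ := h' s' h3
  exact ⟨_, _, .seq h1 h4, Nat.add_le_add h2 h5, h6⟩

theorem Runs.branch {c : Test} {p q : Prog} {s : State} {T : ℕ} {Q : State → Prop}
    (hp : c.Holds s → Runs p s T Q) (hq : ¬ c.Holds s → Runs q s T Q) :
    Runs (.branch c p q) s (1 + T) Q := by
  by_cases hc : c.Holds s
  · obtain ⟨t, s', h1, h2, h3⟩ := hp hc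
    exact ⟨_, _, .branchTrue hc h1, Nat.add_le_add_left h2 1, h3⟩
  · obtain ⟨t, s', h1, h2, h3⟩ := hq hc
    exact ⟨_, _, .branchFalse hc h1, Nat.add_le_add_left h2 1, h3⟩

/-- A loop that makes exactly `m` iterations. -/
theorem Runs.loop {c : Test} {p : Prog} {T m : ℕ} {I : ℕ → State → Prop}
    (hstep : ∀ j < m, ∀ s, I j s → c.Holds s ∧ Runs p s T (I (j + 1)))
    (hend : ∀ s, I m s → ¬ c.Holds s) {s : State} (h0 : I 0 s) :
    Runs (.loop c p) s (m * (1 + T) + 1) (I m) := by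
  -- Induction on the number `r` of iterations still to come.
  suffices H : ∀ r ≤ m, ∀ s, I (m - r) s → Runs (.loop c p) s (r * (1 + T) + 1) (I m) from
    H m le_rfl s (by simpa using h0)
  intro r
  induction r with
  | zero => exact fun _ s hs => ⟨1, s, .loopFalse (hend s hs), by omega, hs⟩
  | succ r ih =>
    intro hr s hs
    obtain ⟨hc, t, s', h1, h2, h3⟩ := hstep (m - (r + 1)) (by omega) s hs
    rw [show m - (r + 1) + 1 = m - r by omega] at h3
    obtain ⟨t', s'', h4, h5, h6⟩ := ih (by omega) s' h3
    refine ⟨_, _, .loopTrue hc h1 h4, ?_, h6⟩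
    rw [Nat.succ_mul]
    omega

/-- A straight-line program. -/
def Prog.block : List Instr → Prog
  | [] => .skip
  | e :: l => .seq (.instr e) (block l)

theorem Runs.block {l : List Instr} {s : State} {Q : State → Prop}
    (h : Q (l.foldl (fun s e => e.apply s) s)) : Runs (.block l) s (l.length + 1) Q := by
  induction l generalizing s with
  | nil => exact Runs.skip h
  | cons e l ih =>
    refine (Runs.seq (R := fun s' => s' = e.apply s) (Runs.instr rfl) ?_).mono
      (T := 1 + (l.length + 1)) (by simp; omega) (fun _ => id)
    rintro s' rfl
    exact ih h

/-- The programs of a list, one after the other. -/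
def Prog.seqs : List Prog → Prog
  | [] => .skip
  | p :: l => .seq p (seqs l)

end RealRAM

/-! ### Reading the memory after a write -/

namespace RealRAM

section Reads

variable (s : State) (A B i r q v : ℕ) (x : ℝ)

theorem State.setI_ireg : (s.setI r v).ireg q = if q = r then v else s.ireg q := by
  simp [State.setI, Function.update_apply]
theorem State.setI_rreg : (s.setI r v).rreg = s.rreg := rfl
theorem State.setI_iarr : (s.setI r v).iarr = s.iarr := rfl
theorem State.setI_rarr : (s.setI r v).rarr = s.rarr := rfl
theorem State.setR_rreg : (s.setR r x).rreg q = if q = r then x else s.rreg q := by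
  simp [State.setR, Function.update_apply]
theorem State.setR_ireg : (s.setR r x).ireg = s.ireg := rfl
theorem State.setR_iarr : (s.setR r x).iarr = s.iarr := rfl
theorem State.setR_rarr : (s.setR r x).rarr = s.rarr := rfl
theorem State.setIArr_iarr : (s.setIArr A i v).iarr B =
    if B = A then Function.update (s.iarr A) i v else s.iarr B := by
  simp [State.setIArr, Function.update_apply]
theorem State.setIArr_ireg : (s.setIArr A i v).ireg = s.ireg := rfl
theorem State.setIArr_rreg : (s.setIArr A i v).rreg = s.rreg := rfl
theorem State.setIArr_rarr : (s.setIArr A i v).rarr = s.rarr := rfl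
theorem State.setRArr_rarr : (s.setRArr A i x).rarr B =
    if B = A then Function.update (s.rarr A) i x else s.rarr B := by
  simp [State.setRArr, Function.update_apply]
theorem State.setRArr_ireg : (s.setRArr A i x).ireg = s.ireg := rfl
theorem State.setRArr_rreg : (s.setRArr A i x).rreg = s.rreg := rfl
theorem State.setRArr_iarr : (s.setRArr A i x).iarr = s.iarr := rfl

end Reads

attribute [simp] State.setI_ireg State.setI_rreg State.setI_iarr State.setI_rarr
  State.setR_rreg State.setR_ireg State.setR_iarr State.setR_rarr
  State.setIArr_iarr State.setIArr_ireg State.setIArr_rreg State.setIArr_rarr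
  State.setRArr_rarr State.setRArr_ireg State.setRArr_rreg State.setRArr_iarr

end RealRAM

/-! ### The list of points in memory -/

/-- A weighted point `(x, y, w)` of the plane. -/
abbrev WPoint := ℝ × ℝ × ℝ

/-- The array that lists one attribute of the points of a list. -/
noncomputable def attrArray (f : WPoint → ℝ) (l : List WPoint) (i : ℕ) : ℝ :=
  if h : i < l.length then f l[i] else 0

theorem attrArray_append (f : WPoint → ℝ) (l : List WPoint) (p : WPoint) :
    Function.update (attrArray f l) l.length (f p) = attrArray f (l ++ [p]) := by
  funext i
  rcases lt_trichotomy i l.length with h | h | h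
  · rw [Function.update_of_ne h.ne]
    simp [attrArray, h, Nat.lt_succ_of_lt h, List.getElem_append_left]
  · subst h
    simp [attrArray]
  · rw [Function.update_of_ne h.ne']
    simp [attrArray, h.not_gt, show ¬ i < l.length + 1 by omega]

/-- The memory while the points are being written: `n` vertices, matrix `a`, constants `0`, `1`
and `M`, tables of `m % n` and `m % n * n` for `m < lim`, two copies of the list of points (in the
arrays `1` to `3` and `40` to `42`), and otherwise zero from name `40` on. -/
structure Building (n : ℕ) (a : ℕ → ℝ) (M : ℝ) (lim : ℕ) (l : List WPoint) (s : State) :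
    Prop where
  ireg_zero : s.ireg 0 = n
  ireg_one : s.ireg 1 = l.length
  ireg_two : s.ireg 2 = 1
  ireg_three : s.ireg 3 = 0
  rreg_zero : s.rreg 0 = 0
  rreg_one : s.rreg 1 = M
  rarr_zero : s.rarr 0 = a
  rarr_xs : s.rarr 1 = attrArray (fun p => p.1) l
  rarr_ys : s.rarr 2 = attrArray (fun p => p.2.1) l
  rarr_ws : s.rarr 3 = attrArray (fun p => p.2.2) l
  rarr_xs' : s.rarr 40 = attrArray (fun p => p.1) l
  rarr_ys' : s.rarr 41 = attrArray (fun p => p.2.1) l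
  rarr_ws' : s.rarr 42 = attrArray (fun p => p.2.2) l
  mod_table : ∀ m < lim, s.iarr 1 m = m % n
  row_table : ∀ m < lim, s.iarr 2 m = m % n * n
  ireg_high : ∀ r, 40 ≤ r → s.ireg r = 0
  rreg_high : ∀ r, 40 ≤ r → s.rreg r = 0
  iarr_high : ∀ A, 40 ≤ A → s.iarr A = fun _ => 0
  rarr_high : ∀ A, 43 ≤ A → s.rarr A = fun _ => 0

namespace Building

variable {n : ℕ} {a : ℕ → ℝ} {M : ℝ} {lim : ℕ} {l : List WPoint} {s : State}

/-- Index registers `4` to `39` are scratch space, as are the real registers `2` to `39` below. -/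
theorem setI (h : Building n a M lim l s) {r v : ℕ} (h1 : 4 ≤ r) (h2 : r < 40) :
    Building n a M lim l (s.setI r v) := by
  obtain ⟨h0, h1, h2, h3, h4, h5, h6, h7, h8, h9, h10, h11, h12, h13, h14, h15, h16, h17, h18⟩ := h
  constructor <;> try assumption
  all_goals simp only [State.setI_ireg]
  iterate 4 rw [if_neg (by omega)]; assumption
  intro q hq
  rw [if_neg (by omega)]; exact h15 q hq

theorem setR (h : Building n a M lim l s) {r : ℕ} {v : ℝ} (h1 : 2 ≤ r) (h2 : r < 40) :
    Building n a M lim l (s.setR r v) := by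
  obtain ⟨h0, h1, h2, h3, h4, h5, h6, h7, h8, h9, h10, h11, h12, h13, h14, h15, h16, h17, h18⟩ := h
  constructor <;> try assumption
  all_goals simp only [State.setR_rreg]
  iterate 2 rw [if_neg (by omega)]; assumption
  intro q hq
  rw [if_neg (by omega)]; exact h16 q hq

end Building

/-- Append the point whose attributes are in the real registers `x`, `y`, `w`. -/
def emitProg (x y w : ℕ) : Prog :=
  .block [.rstore 1 1 x, .rstore 2 1 y, .rstore 3 1 w, .rstore 40 1 x, .rstore 41 1 y,
    .rstore 42 1 w, .iadd 1 1 2]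

/-- The index registers from `lo` to `hi - 1` and all real registers agree. -/
def SameRegs (lo hi : ℕ) (s s' : State) : Prop :=
  (∀ q, lo ≤ q → q < hi → s'.ireg q = s.ireg q) ∧ s'.rreg = s.rreg

theorem runs_emitProg {n : ℕ} {a : ℕ → ℝ} {M : ℝ} {lim : ℕ} {l : List WPoint} {s : State}
    (h : Building n a M lim l s) (x y w : ℕ) :
    Runs (emitProg x y w) s 8 fun s' =>
      Building n a M lim (l ++ [(s.rreg x, s.rreg y, s.rreg w)]) s' ∧ SameRegs 2 40 s s' := by
  refine Runs.block ?_
  simp only [List.foldl, Instr.apply]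
  obtain ⟨h0, h1, h2, h3, h4, h5, h6, h7, h8, h9, h10, h11, h12, h13, h14, h15, h16, h17, h18⟩ := h
  have e1 := attrArray_append (fun p => p.1) l (s.rreg x, s.rreg y, s.rreg w)
  have e2 := attrArray_append (fun p => p.2.1) l (s.rreg x, s.rreg y, s.rreg w)
  have e3 := attrArray_append (fun p => p.2.2) l (s.rreg x, s.rreg y, s.rreg w)
  refine ⟨⟨?_, ?_, ?_, ?_, ?_, ?_, ?_, ?_, ?_, ?_, ?_, ?_, ?_, ?_, ?_, ?_, ?_, ?_, ?_⟩, ?_, ?_⟩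
  · simp [h0]
  · simp [h1, h2]
  · simp [h2]
  · simp [h3]
  · simp [h4]
  · simp [h5]
  · simp [h6]
  · simp [h1, h7, e1]
  · simp [h1, h8, e2]
  · simp [h1, h9, e3]
  · simp [h1, h10, e1]
  · simp [h1, h11, e2]
  · simp [h1, h12, e3]
  · simpa using h13
  · simpa using h14
  · intro r hr
    simp [show r ≠ 1 by omega, h15 r hr]
  · simpa using h16
  · simpa using h17
  · intro r hr
    simp [h18 r hr, show r ≠ 1 by omega, show r ≠ 2 by omega, show r ≠ 3 by omega,
      show r ≠ 40 by omega, show r ≠ 41 by omega, show r ≠ 42 by omega]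
  · intro q hq _
    simp [show q ≠ 1 by omega]
  · rfl

/-- Put `n ^ e` into the index register `r`. -/
def powProg (r : ℕ) : ℕ → Prog
  | 0 => .block [.iconst r 1]
  | e + 1 => .seq (powProg r e) (.seq (.block [.iconst 30 0, .iconst 31 0])
      (.seq (.loop (.ilt 31 0) (.block [.iadd 30 30 r, .iadd 31 31 2]))
        (.block [.iadd r 30 3])))

/-- Indices cannot be multiplied, so each factor `n` is an `n`-fold addition. It costs `3` steps of
set-up, `4 n + 1` for the loop and `2` for copying back. -/
theorem runs_powProg {n : ℕ} {a : ℕ → ℝ} {M : ℝ} {lim : ℕ} {l : List WPoint} {s : State}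
    (h : Building n a M lim l s) {r : ℕ} (hr : 4 ≤ r) (hr' : r < 30) (e : ℕ) :
    Runs (powProg r e) s (e * (4 * n + 6) + 2) fun s' =>
      Building n a M lim l s' ∧ s'.ireg r = n ^ e ∧
        (∀ q, q ≠ r → q < 30 → s'.ireg q = s.ireg q) ∧ s'.rreg = s.rreg := by
  induction e with
  | zero =>
    refine (Runs.block ?_).mono (T := 2) (by simp) (fun _ => id)
    simp only [List.foldl, Instr.apply]
    refine ⟨h.setI (by omega) (by omega), by simp, ?_, rfl⟩
    intro q hq _
    simp [hq]
  | succ e ih =>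
    refine (Runs.seq ih ?_).mono (T := (e * (4 * n + 6) + 2) + (3 + ((n * (1 + 3) + 1) + 2)))
      (by rw [Nat.succ_mul e]; omega) (fun _ => id)
    rintro s₁ ⟨h1, h2, h3, h4⟩
    refine Runs.seq (R := fun s' => Building n a M lim l s' ∧ s'.ireg r = n ^ e ∧
        (∀ q, q ≠ r → q < 30 → s'.ireg q = s.ireg q) ∧ s'.rreg = s.rreg ∧
        s'.ireg 30 = 0 ∧ s'.ireg 31 = 0) (Runs.block ?_) ?_
    · simp only [List.foldl, Instr.apply]
      refine ⟨(h1.setI (by omega) (by omega)).setI (by omega) (by omega), ?_, ?_, h4, by simp,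
        by simp⟩
      · simp [h2, show r ≠ 30 by omega, show r ≠ 31 by omega]
      · intro q hq hq'
        simp [h3 q hq hq', show q ≠ 30 by omega, show q ≠ 31 by omega]
    rintro s₂ ⟨h1, h2, h3, h4, h5, h6⟩
    refine Runs.seq (Runs.loop (I := fun j s' => Building n a M lim l s' ∧ s'.ireg r = n ^ e ∧
        (∀ q, q ≠ r → q < 30 → s'.ireg q = s.ireg q) ∧ s'.rreg = s.rreg ∧
        s'.ireg 30 = j * n ^ e ∧ s'.ireg 31 = j) ?_ ?_ ⟨h1, h2, h3, h4, by simpa, h6⟩) ?_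
    · rintro j hj s' ⟨g1, g2, g3, g4, g5, g6⟩
      refine ⟨by simpa [Test.Holds, g6, g1.ireg_zero], Runs.block ?_⟩
      simp only [List.foldl, Instr.apply]
      refine ⟨(g1.setI (by omega) (by omega)).setI (by omega) (by omega), ?_, ?_, g4, ?_, ?_⟩
      · simp [g2, show r ≠ 30 by omega, show r ≠ 31 by omega]
      · intro q hq hq'
        simp [g3 q hq hq', show q ≠ 30 by omega, show q ≠ 31 by omega]
      · simp [g5, g2, Nat.succ_mul]
      · simp [g6, g1.ireg_two]
    · rintro s' ⟨g1, g2, g3, g4, g5, g6⟩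
      simp [Test.Holds, g6, g1.ireg_zero]
    · rintro s' ⟨g1, g2, g3, g4, g5, g6⟩
      refine Runs.block ?_
      simp only [List.foldl, Instr.apply]
      refine ⟨g1.setI (by omega) (by omega), ?_, ?_, g4⟩
      · simp [g5, g1.ireg_three, Nat.pow_succ, Nat.mul_comm]
      · intro q hq hq'
        simp [hq, g3 q hq hq']

/-! ### Gadgets and the programs that emit them -/

/-- Four signed points whose weights add up to `g` at the corners that see only the first of them,
and cancel elsewhere. -/
def quad (x X y Y g : ℝ) : List WPoint :=
  [(x, y, g), (x + X, y, 0 - g), (x, y + Y, 0 - g), (x + X, y + Y, g)]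

/-- The entry `(u, v)` of the matrix `a`, with the diagonal replaced by `D`. -/
noncomputable def entry (a : ℕ → ℝ) (n : ℕ) (D : ℝ) (u v : ℕ) : ℝ :=
  if u = v then D else a (u * n + v)

/-- In the sparse case, the `γ`-th number with the same last digit as `α`; otherwise `γ`. -/
def prefixIdx (sparse : Bool) (n α γ : ℕ) : ℕ :=
  if sparse then α % n + γ * n else γ

/-- The points that give each pair of prefixes the matrix entry of their last digits. -/
noncomputable def gadgetRow (a : ℕ → ℝ) (n : ℕ) (D X Y : ℝ) (sparse : Bool) (α C : ℕ) :
    List WPoint :=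
  (List.range C).flatMap fun γ =>
    quad (α * X) X (prefixIdx sparse n α γ * Y) Y
      (entry a n D (α % n) (prefixIdx sparse n α γ % n))

/-- The points that give each pair of prefixes the matrix entry of their last digits. -/
noncomputable def gadgetPoints (a : ℕ → ℝ) (n : ℕ) (D X Y : ℝ) (sparse : Bool) (A C : ℕ) :
    List WPoint :=
  (List.range A).flatMap fun α => gadgetRow a n D X Y sparse α C

/-- Emit the four points of one pair of prefixes. -/
def quadProg : Prog :=
  .seq (.block [.rcast 16 17, .rmul 16 16 11, .radd 17 16 11, .iload 19 1 17, .iadd 20 16 19,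
    .rload 18 0 20])
  (.seq (.branch (.ilt 15 19) .skip (.branch (.ilt 19 15) .skip (.block [.radd 18 13 0])))
  (.seq (.block [.rsub 19 0 18])
  (.seq (emitProg 14 16 18)
  (.seq (emitProg 15 16 19)
  (.seq (emitProg 14 17 19)
  (.seq (emitProg 15 17 18)
    (.block [.iadd 17 17 13, .iadd 18 18 2])))))))

/-- The double loop over pairs of prefixes. -/
def gadgetLoop (sparse : Bool) : Prog :=
  .loop (.ilt 14 10)
    (.seq (.block [.rcast 14 14, .rmul 14 14 10, .radd 15 14 10, .iload 15 1 14, .iload 16 2 14,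
      if sparse then .iadd 17 15 3 else .iadd 17 3 3, .iconst 18 0])
    (.seq (.loop (.ilt 18 11) quadProg)
      (.block [.iadd 14 14 2])))

/-- The registers that stay constant in `gadgetLoop`. -/
structure GadgetRegs (A C step : ℕ) (X Y D : ℝ) (s : State) : Prop where
  i10 : s.ireg 10 = A
  i11 : s.ireg 11 = C
  i13 : s.ireg 13 = step
  r10 : s.rreg 10 = X
  r11 : s.rreg 11 = Y
  r13 : s.rreg 13 = D

/-- The registers that stay constant in the inner loop of `gadgetLoop`. -/
structure RowRegs (α n : ℕ) (X : ℝ) (s : State) : Prop where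
  i14 : s.ireg 14 = α
  i15 : s.ireg 15 = α % n
  i16 : s.ireg 16 = α % n * n
  r14 : s.rreg 14 = α * X
  r15 : s.rreg 15 = α * X + X

theorem GadgetRegs.of_same {A C step : ℕ} {X Y D : ℝ} {s s' : State}
    (h : GadgetRegs A C step X Y D s) (hi : ∀ q, 10 ≤ q → q < 14 → s'.ireg q = s.ireg q)
    (hr : ∀ q, 10 ≤ q → q < 14 → s'.rreg q = s.rreg q) : GadgetRegs A C step X Y D s' :=
  ⟨by rw [hi _ (by norm_num) (by norm_num), h.i10],
   by rw [hi _ (by norm_num) (by norm_num), h.i11],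
   by rw [hi _ (by norm_num) (by norm_num), h.i13],
   by rw [hr _ (by norm_num) (by norm_num), h.r10],
   by rw [hr _ (by norm_num) (by norm_num), h.r11],
   by rw [hr _ (by norm_num) (by norm_num), h.r13]⟩

theorem RowRegs.of_same {α n : ℕ} {X : ℝ} {s s' : State}
    (h : RowRegs α n X s) (hi : ∀ q, 14 ≤ q → q < 17 → s'.ireg q = s.ireg q)
    (hr : ∀ q, 14 ≤ q → q < 16 → s'.rreg q = s.rreg q) : RowRegs α n X s' :=
  ⟨by rw [hi _ (by norm_num) (by norm_num), h.i14],
   by rw [hi _ (by norm_num) (by norm_num), h.i15],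
   by rw [hi _ (by norm_num) (by norm_num), h.i16],
   by rw [hr _ (by norm_num) (by norm_num), h.r14],
   by rw [hr _ (by norm_num) (by norm_num), h.r15]⟩

/-- Equality of the last digits is detected as the failure of both strict comparisons; only then is
the loaded entry replaced by `D`. The bound is `48 = 7 + 4 + 2 + 4 * 8 + 3`, with `8` for each point
emitted. -/
theorem runs_quadProg {n : ℕ} {a : ℕ → ℝ} {M : ℝ} {lim : ℕ} {l : List WPoint} {s : State}
    {A C step α β γ : ℕ} {X Y D : ℝ} (h : Building n a M lim l s)
    (hg : GadgetRegs A C step X Y D s) (hr : RowRegs α n X s) (hβ : s.ireg 17 = β)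
    (hγ : s.ireg 18 = γ) (hlim : β < lim) :
    Runs quadProg s 48 fun s' =>
      Building n a M lim (l ++ quad (α * X) X (β * Y) Y (entry a n D (α % n) (β % n))) s' ∧
        GadgetRegs A C step X Y D s' ∧ RowRegs α n X s' ∧ s'.ireg 17 = β + step ∧
        s'.ireg 18 = γ + 1 := by
  have hmod := h.mod_table β hlim
  refine (Runs.seq (T₁ := 7) (T₂ := 41) (R := fun s' => Building n a M lim l s' ∧
    GadgetRegs A C step X Y D s' ∧ RowRegs α n X s' ∧ s'.ireg 17 = β ∧ s'.ireg 18 = γ ∧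
    s'.ireg 19 = β % n ∧ s'.rreg 16 = β * Y ∧ s'.rreg 17 = β * Y + Y ∧
    s'.rreg 18 = a (α % n * n + β % n)) (Runs.block ?_) ?_)
  · simp only [List.foldl, Instr.apply]
    refine ⟨?_, hg.of_same ?_ ?_, hr.of_same ?_ ?_, ?_, ?_, ?_, ?_, ?_, ?_⟩
    · repeat first
        | apply Building.setI _ (by norm_num) (by norm_num)
        | apply Building.setR _ (by norm_num) (by norm_num)
      exact h
    · intro q h1 h2
      simp [show q ≠ 19 by omega, show q ≠ 20 by omega]
    · intro q h1 h2
      simp [show q ≠ 16 by omega, show q ≠ 17 by omega, show q ≠ 18 by omega]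
    · intro q h1 h2
      simp [show q ≠ 19 by omega, show q ≠ 20 by omega]
    · intro q h1 h2
      simp [show q ≠ 16 by omega, show q ≠ 17 by omega, show q ≠ 18 by omega]
    · simp [hβ]
    · simp [hγ]
    · simp [hβ, hmod]
    · simp [hβ, hg.r11]
    · simp [hβ, hg.r11]
    · simp [hβ, hmod, hr.i16, h.rarr_zero]
  clear h hg hr hβ hγ hmod s
  rintro s ⟨h, hg, hr, hβ, hγ, hv, hy, hy', hw⟩
  refine (Runs.seq (T₁ := 4) (T₂ := 37) (R := fun s' => Building n a M lim l s' ∧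
    GadgetRegs A C step X Y D s' ∧ RowRegs α n X s' ∧ s'.ireg 17 = β ∧ s'.ireg 18 = γ ∧
    s'.rreg 16 = β * Y ∧ s'.rreg 17 = β * Y + Y ∧
    s'.rreg 18 = entry a n D (α % n) (β % n)) ?_ ?_)
  · refine Runs.branch (T := 3) (fun hc => ?_) (fun hc => ?_)
    · refine (Runs.skip ⟨h, hg, hr, hβ, hγ, hy, hy', ?_⟩).mono (by norm_num) (fun _ => id)
      simp only [Test.Holds, hr.i15, hv] at hc
      rw [hw, entry, if_neg hc.ne]
    · refine Runs.branch (T := 2) (fun hc' => ?_) (fun hc' => ?_)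
      · refine (Runs.skip ⟨h, hg, hr, hβ, hγ, hy, hy', ?_⟩).mono (by norm_num) (fun _ => id)
        simp only [Test.Holds, hr.i15, hv] at hc'
        rw [hw, entry, if_neg hc'.ne']
      · refine Runs.block ?_
        simp only [Test.Holds, hr.i15, hv] at hc hc'
        simp only [List.foldl, Instr.apply]
        refine ⟨h.setR (by norm_num) (by norm_num), hg.of_same ?_ ?_, hr.of_same ?_ ?_, hβ, hγ,
          by simpa using hy, by simpa using hy', ?_⟩
        · intro q h1 h2; simp
        · intro q h1 h2; simp [show q ≠ 18 by omega]
        · intro q h1 h2; simp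
        · intro q h1 h2; simp [show q ≠ 18 by omega]
        · simp [entry, show α % n = β % n by omega, hg.r13, h.rreg_zero]
  clear h hg hr hβ hγ hv hy hy' hw s
  rintro s ⟨h, hg, hr, hβ, hγ, hy, hy', hw⟩
  refine (Runs.seq (T₁ := 2) (T₂ := 35) (R := fun s' => Building n a M lim l s' ∧
    GadgetRegs A C step X Y D s' ∧ RowRegs α n X s' ∧ s'.ireg 17 = β ∧ s'.ireg 18 = γ ∧
    s'.rreg 16 = β * Y ∧ s'.rreg 17 = β * Y + Y ∧
    s'.rreg 18 = entry a n D (α % n) (β % n) ∧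
    s'.rreg 19 = 0 - entry a n D (α % n) (β % n)) (Runs.block ?_) ?_)
  · simp only [List.foldl, Instr.apply]
    refine ⟨h.setR (by norm_num) (by norm_num), hg.of_same ?_ ?_, hr.of_same ?_ ?_, hβ, hγ,
          by simpa using hy, by simpa using hy', by simpa using hw, ?_⟩
    · intro q h1 h2; simp
    · intro q h1 h2; simp [show q ≠ 19 by omega]
    · intro q h1 h2; simp
    · intro q h1 h2; simp [show q ≠ 19 by omega]
    · simp [h.rreg_zero, hw]
  clear h hg hr hβ hγ hy hy' hw s
  rintro s ⟨h, hg, hr, hβ, hγ, hy, hy', hw, hw'⟩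
  refine Runs.seq (T₁ := 8) (T₂ := 27) (runs_emitProg h _ _ _) ?_
  rintro s₁ ⟨h₁, hi₁, hr₁⟩
  refine Runs.seq (T₁ := 8) (T₂ := 19) (runs_emitProg h₁ _ _ _) ?_
  rintro s₂ ⟨h₂, hi₂, hr₂⟩
  refine Runs.seq (T₁ := 8) (T₂ := 11) (runs_emitProg h₂ _ _ _) ?_
  rintro s₃ ⟨h₃, hi₃, hr₃⟩
  refine Runs.seq (T₁ := 8) (T₂ := 3) (runs_emitProg h₃ _ _ _) ?_
  rintro s₄ ⟨h₄, hi₄, hr₄⟩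
  refine Runs.block ?_
  rw [hr₃, hr₂, hr₁, hr.r14, hr.r15, hy, hy', hw, hw'] at h₄
  have hi : ∀ q, 10 ≤ q → q < 20 → s₄.ireg q = s.ireg q := by
    intro q h1 h2
    rw [hi₄ q (by omega) (by omega), hi₃ q (by omega) (by omega), hi₂ q (by omega) (by omega),
      hi₁ q (by omega) (by omega)]
  have hrr : s₄.rreg = s.rreg := by rw [hr₄, hr₃, hr₂, hr₁]
  simp only [List.foldl, Instr.apply]
  refine ⟨(Building.setI ?_ (by norm_num) (by norm_num)).setI (by norm_num) (by norm_num),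
    hg.of_same ?_ ?_, hr.of_same ?_ ?_, ?_, ?_⟩
  · simpa [quad] using h₄
  · intro q h1 h2
    simp [show q ≠ 17 by omega, show q ≠ 18 by omega, hi q (by omega) (by omega)]
  · intro q h1 h2
    simp [hrr]
  · intro q h1 h2
    simp [show q ≠ 17 by omega, show q ≠ 18 by omega, hi q (by omega) (by omega)]
  · intro q h1 h2
    simp [hrr]
  · simp [hi 17 (by norm_num) (by norm_num), hi 13 (by norm_num) (by norm_num), hβ, hg.i13]
  · simp [hi 18 (by norm_num) (by norm_num), hγ, h₄.ireg_two]

/-- The invariants of both loops say which part of the list has been written. Register `17` runs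
through the second prefixes in steps of `n` (sparse) or `1`, so no index is ever multiplied or
divided; last digits and row offsets come from the tables. -/
theorem runs_gadgetLoop {n : ℕ} {a : ℕ → ℝ} {M : ℝ} {lim : ℕ} {l : List WPoint} {s : State}
    {A C : ℕ} {X Y D : ℝ} (sparse : Bool) (h : Building n a M lim l s)
    (hg : GadgetRegs A C (if sparse then n else 1) X Y D s) (h0 : s.ireg 14 = 0)
    (hA : A ≤ lim) (hC : ∀ α < A, ∀ γ < C, prefixIdx sparse n α γ < lim) :
    Runs (gadgetLoop sparse) s (A * (1 + (8 + ((C * 49 + 1) + 2))) + 1) fun s' =>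
      Building n a M lim (l ++ gadgetPoints a n D X Y sparse A C) s' := by
  refine (Runs.loop (I := fun α s' =>
    Building n a M lim (l ++ gadgetPoints a n D X Y sparse α C) s' ∧
    GadgetRegs A C (if sparse then n else 1) X Y D s' ∧ s'.ireg 14 = α) ?_ ?_ ?_).mono le_rfl
    (fun s' hs => hs.1)
  · rintro α hα s ⟨h, hg, h0⟩
    refine ⟨by simpa [Test.Holds, h0, hg.i10], ?_⟩
    have ht := h.mod_table α (by omega)
    have ht' := h.row_table α (by omega)
    refine Runs.seq (T₁ := 8) (R := fun s' =>
      Building n a M lim (l ++ gadgetPoints a n D X Y sparse α C) s' ∧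
      GadgetRegs A C (if sparse then n else 1) X Y D s' ∧ RowRegs α n X s' ∧
      s'.ireg 17 = prefixIdx sparse n α 0 ∧ s'.ireg 18 = 0) (Runs.block ?_) ?_
    · cases sparse
      all_goals
        simp only [List.foldl, Instr.apply, if_true, Bool.false_eq_true, if_false]
        refine ⟨?_, hg.of_same ?_ ?_, ⟨?_, ?_, ?_, ?_, ?_⟩, ?_, ?_⟩
        · repeat first
            | apply Building.setI _ (by norm_num) (by norm_num)
            | apply Building.setR _ (by norm_num) (by norm_num)
          exact h
        · intro q h1 h2
          simp [show q ≠ 15 by omega, show q ≠ 16 by omega, show q ≠ 17 by omega,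
            show q ≠ 18 by omega]
        · intro q h1 h2
          simp [show q ≠ 14 by omega, show q ≠ 15 by omega]
        · simp [h0]
        · simp [h0, ht]
        · simp [h0, ht']
        · simp [h0, hg.r10]
        · simp [h0, hg.r10]
        · simp [h0, ht, h.ireg_three, prefixIdx]
        · simp
    clear h hg h0 ht ht' s
    rintro s ⟨h, hg, hr, h17, h18⟩
    refine Runs.seq (R := fun s' =>
      Building n a M lim (l ++ gadgetPoints a n D X Y sparse (α + 1) C) s' ∧
      GadgetRegs A C (if sparse then n else 1) X Y D s' ∧ RowRegs α n X s')
      ((Runs.loop (T := 48) (m := C) (I := fun γ s' =>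
      Building n a M lim ((l ++ gadgetPoints a n D X Y sparse α C) ++
        gadgetRow a n D X Y sparse α γ) s' ∧
      GadgetRegs A C (if sparse then n else 1) X Y D s' ∧ RowRegs α n X s' ∧
      s'.ireg 17 = prefixIdx sparse n α γ ∧ s'.ireg 18 = γ) ?_ ?_ ?_).mono le_rfl ?_) ?_
    · rintro γ hγ s ⟨h, hg, hr, h17, h18⟩
      refine ⟨by simpa [Test.Holds, h18, hg.i11], ?_⟩
      refine (runs_quadProg h hg hr h17 h18 (hC α hα γ hγ)).mono le_rfl ?_
      rintro s' ⟨g1, g2, g3, g4, g5⟩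
      refine ⟨?_, g2, g3, ?_, g5⟩
      · simpa [gadgetRow, List.range_succ] using g1
      · rw [g4]
        cases sparse <;> simp [prefixIdx, Nat.succ_mul, Nat.add_assoc]
    · rintro s ⟨h, hg, hr, h17, h18⟩
      simp [Test.Holds, h18, hg.i11]
    · exact ⟨by simpa [gadgetRow] using h, hg, hr, h17, h18⟩
    · rintro s ⟨h, hg, hr, -, -⟩
      exact ⟨by simpa [gadgetPoints, List.range_succ] using h, hg, hr⟩
    · rintro s ⟨h, hg, hr⟩
      refine Runs.block ?_
      simp only [List.foldl, Instr.apply]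
      refine ⟨h.setI (by norm_num) (by norm_num), hg.of_same ?_ ?_, ?_⟩
      · intro q h1 h2
        simp [show q ≠ 14 by omega]
      · intro q h1 h2
        simp
      · simp [hr.i14, h.ireg_two]
  · rintro s ⟨h, hg, h0⟩
    simp [Test.Holds, h0, hg.i10]
  · exact ⟨by simpa [gadgetPoints] using h, hg, h0⟩

/-- Emit the points of one gadget with prefixes of length `i` and `j`. -/
def gadgetProg (i c j : ℕ) (σ τ κ : ℤ) (sparse : Bool) : Prog :=
  .seq (powProg 10 i) (.seq (powProg 11 c) (.seq (powProg 12 j)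
    (.seq (.block [.rcast 10 10, .rconst 12 σ, .rdiv 10 12 10, .rcast 11 12, .rconst 12 τ,
      .rdiv 11 12 11, .rconst 12 κ, .rmul 13 12 1,
      if sparse then .iadd 13 0 3 else .iadd 13 2 3, .iconst 14 0])
    (gadgetLoop sparse))))

theorem runs_gadgetProg {n : ℕ} {a : ℕ → ℝ} {M : ℝ} {lim : ℕ} {l : List WPoint} {s : State}
    (i c j : ℕ) (σ τ κ : ℤ) (sparse : Bool) (h : Building n a M lim l s)
    (hA : n ^ i ≤ lim) (hC : ∀ α < n ^ i, ∀ γ < n ^ c, prefixIdx sparse n α γ < lim) :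
    Runs (gadgetProg i c j σ τ κ sparse) s
      ((i * (4 * n + 6) + 2) + ((c * (4 * n + 6) + 2) + ((j * (4 * n + 6) + 2) +
        (11 + (n ^ i * (1 + (8 + ((n ^ c * 49 + 1) + 2))) + 1))))) fun s' =>
      Building n a M lim (l ++ gadgetPoints a n (κ * M) (σ / (n : ℝ) ^ i) (τ / (n : ℝ) ^ j)
        sparse (n ^ i) (n ^ c)) s' := by
  refine Runs.seq (runs_powProg h (by norm_num) (by norm_num) i) ?_
  rintro s₁ ⟨h₁, e₁, -, -⟩
  refine Runs.seq (runs_powProg h₁ (by norm_num) (by norm_num) c) ?_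
  rintro s₂ ⟨h₂, e₂, f₂, -⟩
  refine Runs.seq (runs_powProg h₂ (by norm_num) (by norm_num) j) ?_
  rintro s₃ ⟨h₃, e₃, f₃, -⟩
  have g10 : s₃.ireg 10 = n ^ i := by
    rw [f₃ _ (by norm_num) (by norm_num), f₂ _ (by norm_num) (by norm_num), e₁]
  have g11 : s₃.ireg 11 = n ^ c := by
    rw [f₃ _ (by norm_num) (by norm_num), e₂]
  refine Runs.seq (R := fun s' => Building n a M lim l s' ∧
    GadgetRegs (n ^ i) (n ^ c) (if sparse then n else 1) (σ / (n : ℝ) ^ i) (τ / (n : ℝ) ^ j)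
      (κ * M) s' ∧ s'.ireg 14 = 0) (Runs.block ?_) ?_
  · cases sparse
    all_goals
      simp only [List.foldl, Instr.apply, if_true, Bool.false_eq_true, if_false]
      refine ⟨?_, ⟨?_, ?_, ?_, ?_, ?_, ?_⟩, ?_⟩
      · repeat first
          | apply Building.setI _ (by norm_num) (by norm_num)
          | apply Building.setR _ (by norm_num) (by norm_num)
        exact h₃
      · simp [g10]
      · simp [g11]
      · simp [h₃.ireg_zero, h₃.ireg_two, h₃.ireg_three]
      · simp [g10]
      · simp [e₃]
      · simp [h₃.rreg_one]
      · simp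
  · rintro s₄ ⟨h₄, hg, h0⟩
    exact runs_gadgetLoop sparse h₄ hg h0 hA hC

theorem runs_seqs {n : ℕ} {a : ℕ → ℝ} {M : ℝ} {lim : ℕ} {ι : Type*} (L : List ι)
    (p : ι → Prog) (q : ι → List WPoint) (T : ℕ)
    (H : ∀ x ∈ L, ∀ l s, Building n a M lim l s →
      Runs (p x) s T fun s' => Building n a M lim (l ++ q x) s')
    {l : List WPoint} {s : State} (h : Building n a M lim l s) :
    Runs (.seqs (L.map p)) s (L.length * T + 1) fun s' =>
      Building n a M lim (l ++ L.flatMap q) s' := by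
  induction L generalizing l s with
  | nil => exact (Runs.skip (by simpa using h)).mono (by simp) (fun _ => id)
  | cons x L ih =>
    refine (Runs.seq (H x (by simp) l s h) (fun s' h' => ih (fun y hy => H y (by simp [hy])) h')).mono
      (by simp [Nat.succ_mul]; omega) ?_
    intro s' h'
    simpa using h'

/-! ### The gadgets of all pairs of digits and the number of points -/

/-- The pairs `a ≤ b < k`. -/
def digitPairs (k : ℕ) : List (ℕ × ℕ) :=
  (List.range k).flatMap fun b => (List.range (b + 1)).map fun a => (a, b)

/-- Length of the prefix on the first axis that ends with the digit `a`. -/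
def fstDepth (a : ℕ) : ℕ := a / 2 + 1

/-- Length of the prefix on the second axis that ends with the digit `b`. -/
def sndDepth (k b : ℕ) : ℕ := (k + 1 - b) / 2

/-- Number of digits over which the inner loop of the gadget of `(a, b)` runs. -/
def innerDepth (k a b : ℕ) : ℕ := if a = b then sndDepth k b - 1 else sndDepth k b

/-- The program of the gadget of the digits `a ≤ b`. -/
def pairProg (k : ℕ) (x : ℕ × ℕ) : Prog :=
  gadgetProg (fstDepth x.1) (innerDepth k x.1 x.2) (sndDepth k x.2) ((-1) ^ (x.1 + 1))
    ((-1) ^ (x.2 + 1)) (if x.1 = x.2 then 1 else -1) (decide (x.1 = x.2))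

/-- The points of the gadget of the digits `a ≤ b`. -/
noncomputable def pairPoints (k n : ℕ) (m : ℕ → ℝ) (M : ℝ) (x : ℕ × ℕ) : List WPoint :=
  gadgetPoints m n (((if x.1 = x.2 then 1 else -1 : ℤ) : ℝ) * M)
    (((-1) ^ (x.1 + 1) : ℤ) / (n : ℝ) ^ fstDepth x.1)
    (((-1) ^ (x.2 + 1) : ℤ) / (n : ℝ) ^ sndDepth k x.2)
    (decide (x.1 = x.2)) (n ^ fstDepth x.1) (n ^ innerDepth k x.1 x.2)

theorem mem_digitPairs {k : ℕ} {x : ℕ × ℕ} : x ∈ digitPairs k ↔ x.1 ≤ x.2 ∧ x.2 < k := by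
  obtain ⟨a, b⟩ := x
  simp only [digitPairs, List.mem_flatMap, List.mem_range, List.mem_map, Prod.mk.injEq]
  constructor
  · rintro ⟨b', hb', a', ha', rfl, rfl⟩
    omega
  · rintro ⟨h1, h2⟩
    exact ⟨b, h2, a, by omega, rfl, rfl⟩

/-- The reason for the opposite orders on the two axes: for `a < b` the `a / 2` digits before `a` on
one axis and those before `b` on the other have indices on disjoint sides. For `a = b` the prefixes
overlap in the common last digit, which `innerDepth` counts only once. -/
theorem fstDepth_add_innerDepth_le {k : ℕ} {x : ℕ × ℕ} (hx : x ∈ digitPairs k) :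
    fstDepth x.1 + innerDepth k x.1 x.2 ≤ k / 2 + 1 := by
  obtain ⟨h1, h2⟩ := mem_digitPairs.1 hx
  unfold fstDepth innerDepth sndDepth
  split_ifs <;> omega

theorem runs_pairProg {k n : ℕ} {m : ℕ → ℝ} {M : ℝ} {l : List WPoint} {s : State}
    (hn : 1 ≤ n) (x : ℕ × ℕ) (hx : x ∈ digitPairs k)
    (h : Building n m M (n ^ (k / 2 + 1)) l s) :
    Runs (pairProg k x) s ((30 * k + 150) * n ^ (k / 2 + 1)) fun s' =>
      Building n m M (n ^ (k / 2 + 1)) (l ++ pairPoints k n m M x) s' := by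
  obtain ⟨h1, h2⟩ := mem_digitPairs.1 hx
  have hd := fstDepth_add_innerDepth_le hx
  have hi : fstDepth x.1 ≤ k := by unfold fstDepth; omega
  have hj : sndDepth k x.2 ≤ k := by unfold sndDepth; omega
  have hc : innerDepth k x.1 x.2 ≤ k := by unfold innerDepth; split_ifs <;> omega
  have hA : n ^ fstDepth x.1 ≤ n ^ (k / 2 + 1) := Nat.pow_le_pow_right hn (by omega)
  have hAC : n ^ fstDepth x.1 * n ^ innerDepth k x.1 x.2 ≤ n ^ (k / 2 + 1) := by
    rw [← pow_add]
    exact Nat.pow_le_pow_right hn hd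
  have hnD : n ≤ n ^ (k / 2 + 1) := Nat.le_self_pow (by omega) n
  have hD1 : 1 ≤ n ^ (k / 2 + 1) := Nat.one_le_pow _ _ hn
  refine (runs_gadgetProg _ _ _ _ _ _ _ h hA ?_).mono ?_ (fun _ => id)
  · intro α hα γ hγ
    -- The second prefix is looked up in the tables too, so it must stay below their length; in the
    -- sparse case `α % n + γ * n` has one digit more than `γ`.
    have hsnd : n ^ sndDepth k x.2 ≤ n ^ (k / 2 + 1) :=
      Nat.pow_le_pow_right hn (by unfold sndDepth; omega)
    refine lt_of_lt_of_le ?_ hsnd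
    unfold prefixIdx
    by_cases e : x.1 = x.2
    · simp only [e, decide_true, if_true]
      have e1 : innerDepth k x.1 x.2 = sndDepth k x.2 - 1 := by simp [innerDepth, e]
      have e2 : sndDepth k x.2 = (sndDepth k x.2 - 1) + 1 := by unfold sndDepth; omega
      rw [e1] at hγ
      rw [e2, pow_succ]
      have := Nat.mod_lt α (show 0 < n by omega)
      calc α % n + γ * n < n + γ * n := by omega
        _ = (γ + 1) * n := by ring
        _ ≤ _ := Nat.mul_le_mul_right n hγ
    · simpa [e, innerDepth] using hγ
  · set Y := n ^ (k / 2 + 1)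
    set A := n ^ fstDepth x.1
    set C := n ^ innerDepth k x.1 x.2
    have b : ∀ e ≤ k, e * (4 * n + 6) ≤ 10 * k * Y := fun e he =>
      calc e * (4 * n + 6) ≤ k * (10 * Y) := Nat.mul_le_mul he (by omega)
        _ = _ := by ring
    have b1 := b _ hi
    have b2 := b _ hj
    have b3 := b _ hc
    have b4 : A * (1 + (8 + ((C * 49 + 1) + 2))) = 49 * (A * C) + 12 * A := by ring
    have b5 : (30 * k + 150) * Y = 10 * k * Y + 10 * k * Y + 10 * k * Y + 150 * Y := by ring
    rw [b4, b5]
    omega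

/-- All points except for the one at the origin. -/
noncomputable def reductionPoints (k n : ℕ) (m : ℕ → ℝ) (M : ℝ) : List WPoint :=
  (digitPairs k).flatMap (pairPoints k n m M)

theorem gadgetPoints_length (m : ℕ → ℝ) (n : ℕ) (D X Y : ℝ) (sparse : Bool) (A C : ℕ) :
    (gadgetPoints m n D X Y sparse A C).length = A * (C * 4) := by
  simp [gadgetPoints, gadgetRow, quad, List.length_flatMap]

/-- The number of points other than the origin. -/
def numPoints (k n : ℕ) : ℕ :=
  ((digitPairs k).map fun x => n ^ fstDepth x.1 * (n ^ innerDepth k x.1 x.2 * 4)).sum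

theorem reductionPoints_length (k n : ℕ) (m : ℕ → ℝ) (M : ℝ) :
    (reductionPoints k n m M).length = numPoints k n := by
  simp [reductionPoints, numPoints, List.length_flatMap, pairPoints, gadgetPoints_length]

theorem numPoints_le (k : ℕ) {n : ℕ} (hn : 1 ≤ n) :
    numPoints k n ≤ (digitPairs k).length * (4 * n ^ (k / 2 + 1)) := by
  refine (List.sum_le_card_nsmul _ (4 * n ^ (k / 2 + 1)) ?_).trans (by simp)
  intro y hy
  obtain ⟨x, hx, rfl⟩ := List.mem_map.1 hy
  rw [← mul_assoc, ← pow_add, mul_comm]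
  exact Nat.mul_le_mul_left 4 (Nat.pow_le_pow_right hn (fstDepth_add_innerDepth_le hx))

/-- Makes the number of points tend to infinity with `n`, as is needed to use an asymptotic bound on
`T`. The gadget of `(0, 0)` alone is large enough. -/
theorem le_numPoints {k : ℕ} (hk : 1 ≤ k) {n : ℕ} (hn : 1 ≤ n) : n ≤ numPoints k n := by
  refine le_trans ?_ (List.single_le_sum (fun _ _ => Nat.zero_le _) _
    (List.mem_map.2 ⟨(0, 0), mem_digitPairs.2 ⟨le_rfl, hk⟩, rfl⟩))
  simp only [fstDepth, Nat.zero_div, zero_add, pow_one]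
  have := Nat.one_le_pow (innerDepth k 0 0) n hn
  nlinarith

/-! ### Preparations -/

theorem Building.extend {n : ℕ} {a : ℕ → ℝ} {M : ℝ} {lim : ℕ} {l : List WPoint} {s : State}
    (h : Building n a M lim l s) {u v : ℕ} (hu : u = lim % n) (hv : v = lim % n * n) :
    Building n a M (lim + 1) l ((s.setIArr 1 lim u).setIArr 2 lim v) := by
  obtain ⟨h0, h1, h2, h3, h4, h5, h6, h7, h8, h9, h10, h11, h12, h13, h14, h15, h16, h17, h18⟩ := h
  constructor <;> try assumption
  · intro m hm
    by_cases e : m = lim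
    · simp [e, hu]
    · simp [Function.update_of_ne e, h13 m (by omega)]
  · intro m hm
    by_cases e : m = lim
    · simp [e, hv]
    · simp [Function.update_of_ne e, h14 m (by omega)]
  · intro A hA
    simp [show A ≠ 1 by omega, show A ≠ 2 by omega, h17 A hA]

theorem Building.setWeight {n : ℕ} {a : ℕ → ℝ} {M : ℝ} {lim : ℕ} {l : List WPoint} {s : State}
    (h : Building n a M lim l s) (M' : ℝ) : Building n a M' lim l (s.setR 1 M') := by
  obtain ⟨h0, h1, h2, h3, h4, h5, h6, h7, h8, h9, h10, h11, h12, h13, h14, h15, h16, h17, h18⟩ := h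
  constructor <;> try assumption
  · simp
  · intro q hq
    simp [show q ≠ 1 by omega, h16 q hq]

theorem building_cliqueInput {n : ℕ} (w : Fin n → Fin n → ℝ) :
    Building n ((cliqueInput w).rarr 0) 0 0 [] ((cliqueInput w).setI 2 1) := by
  have hz : ∀ A, A ≠ 0 → (cliqueInput w).rarr A = fun _ => 0 := by
    intro A hA
    funext m
    simp [cliqueInput, hA]
  have ha : ∀ f, attrArray f [] = fun _ => 0 := by
    intro f
    funext m
    simp [attrArray]
  constructor
  · simp [cliqueInput]
  · simp [cliqueInput]
  · simp
  · simp [cliqueInput]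
  · simp [cliqueInput]
  · simp [cliqueInput]
  · rfl
  · rw [ha]; exact hz 1 (by norm_num)
  · rw [ha]; exact hz 2 (by norm_num)
  · rw [ha]; exact hz 3 (by norm_num)
  · rw [ha]; exact hz 40 (by norm_num)
  · rw [ha]; exact hz 41 (by norm_num)
  · rw [ha]; exact hz 42 (by norm_num)
  · simp
  · simp
  · intro r hr
    simp [cliqueInput, show r ≠ 2 by omega, show r ≠ 0 by omega]
  · intro r hr
    simp [cliqueInput]
  · intro r hr
    simp only [State.setI_iarr]
    rfl
  · intro A hA
    exact hz A (by omega)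

/-- Fill the tables of `m % n` and `m % n * n`. -/
def tableLoop : Prog :=
  .loop (.ilt 11 10) (.seq
    (.branch (.ilt 11 0) (.block [.istore 1 11 11, .istore 2 11 12, .iadd 12 12 0])
      (.block [.isub 13 11 0, .iload 14 1 13, .iload 15 2 13, .istore 1 11 14, .istore 2 11 15]))
    (.block [.iadd 11 11 2]))

/-- The tables are filled without division through `m % n = (m - n) % n` for `m ≥ n`; for `m < n`
the entries are `m` and `m * n`. -/
theorem runs_tableLoop {n : ℕ} {a : ℕ → ℝ} {M : ℝ} {lim : ℕ} {l : List WPoint} {s : State}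
    (hn : 1 ≤ n) (h : Building n a M 0 l s) (h10 : s.ireg 10 = lim) (h11 : s.ireg 11 = 0)
    (h12 : s.ireg 12 = 0) :
    Runs tableLoop s (lim * (1 + 9) + 1) fun s' => Building n a M lim l s' := by
  -- Register `12` accumulates `m * n` during the first `n` rounds and is then left alone, hence the
  -- `min`.
  refine (Runs.loop (I := fun m s' => Building n a M m l s' ∧ s'.ireg 10 = lim ∧
    s'.ireg 11 = m ∧ s'.ireg 12 = min m n * n) ?_ ?_ ?_).mono le_rfl (fun s' hs => hs.1)
  · rintro m hm s ⟨h, h10, h11, h12⟩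
    refine ⟨by simpa [Test.Holds, h10, h11], ?_⟩
    refine Runs.seq (T₁ := 7) (T₂ := 2) (R := fun s' => Building n a M (m + 1) l s' ∧
      s'.ireg 10 = lim ∧ s'.ireg 11 = m ∧ s'.ireg 12 = min (m + 1) n * n)
      (Runs.branch (T := 6) (fun hc => ?_) (fun hc => ?_)) ?_
    · simp only [Test.Holds, h11, h.ireg_zero] at hc
      refine (Runs.block ?_).mono (T := 4) (by norm_num) (fun _ => id)
      simp only [List.foldl, Instr.apply]
      refine ⟨?_, by simpa using h10, by simpa using h11, ?_⟩
      · refine Building.setI ?_ (by norm_num) (by norm_num)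
        simp only [State.setIArr_ireg, h11, h12]
        exact h.extend (Nat.mod_eq_of_lt hc).symm (by rw [Nat.mod_eq_of_lt hc, min_eq_left hc.le])
      · simp [h12, h.ireg_zero, min_eq_left hc.le, min_eq_left (Nat.succ_le_of_lt hc),
          Nat.succ_mul]
    · simp only [Test.Holds, h11, h.ireg_zero] at hc
      refine Runs.block ?_
      simp only [List.foldl, Instr.apply]
      have e := Nat.mod_eq_sub_mod (not_lt.1 hc)
      refine ⟨?_, by simpa using h10, by simpa using h11, ?_⟩
      · have h' := (((h.setI (r := 13) (v := m - n) (by norm_num) (by norm_num)).setI (r := 14)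
          (v := (m - n) % n) (by norm_num) (by norm_num)).setI (r := 15)
          (v := (m - n) % n * n) (by norm_num) (by norm_num)).extend (u := (m - n) % n)
          (v := (m - n) % n * n) e.symm (by rw [e])
        simpa [h11, h.ireg_zero, h.mod_table (m - n) (by omega),
          h.row_table (m - n) (by omega)] using h'
      · simp [h12, min_eq_right (not_lt.1 hc), min_eq_right (show n ≤ m + 1 by omega)]
    · rintro s' ⟨g, g10, g11, g12⟩
      refine Runs.block ?_
      simp only [List.foldl, Instr.apply]
      exact ⟨g.setI (by norm_num) (by norm_num), by simpa using g10, by simp [g11, g.ireg_two],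
        by simpa using g12⟩
  · rintro s ⟨h, h10, h11, h12⟩
    simp [Test.Holds, h10, h11]
  · exact ⟨h, h10, h11, by simpa using h12⟩

/-- A bound for the absolute value of each entry of an `n × n` matrix. -/
noncomputable def entryBound (n : ℕ) (a : ℕ → ℝ) : ℝ :=
  ∑ m ∈ Finset.range (n ^ 2), (a m * a m + 1)

/-- A weight that dominates all edge weights of a `k`-clique. -/
noncomputable def bigWeight (k n : ℕ) (a : ℕ → ℝ) : ℝ :=
  ((2 * k ^ 2 : ℕ) : ℤ) * entryBound n a + 1

/-- Compute the dominating weight. -/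
def weightProg (k : ℕ) : Prog :=
  .seq (powProg 10 2) (.seq (.block [.iconst 11 0, .rconst 2 0, .rconst 3 1])
    (.seq (.loop (.ilt 11 10)
      (.block [.rload 5 0 11, .rmul 5 5 5, .radd 5 5 3, .radd 2 2 5, .iadd 11 11 2]))
    (.block [.rconst 4 ((2 * k ^ 2 : ℕ) : ℤ), .rmul 4 4 2, .radd 1 4 3])))

theorem runs_weightProg (k : ℕ) {n : ℕ} {a : ℕ → ℝ} {M : ℝ} {lim : ℕ} {l : List WPoint}
    {s : State} (h : Building n a M lim l s) :
    Runs (weightProg k) s ((2 * (4 * n + 6) + 2) + (4 + ((n ^ 2 * (1 + 6) + 1) + 4))) fun s' =>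
      Building n a (bigWeight k n a) lim l s' := by
  refine Runs.seq (runs_powProg h (by norm_num) (by norm_num) 2) ?_
  rintro s₁ ⟨h₁, e₁, -, -⟩
  refine Runs.seq (R := fun s' => Building n a M lim l s' ∧ s'.ireg 10 = n ^ 2 ∧
    s'.ireg 11 = 0 ∧ s'.rreg 2 = 0 ∧ s'.rreg 3 = 1) (Runs.block ?_) ?_
  · simp only [List.foldl, Instr.apply]
    refine ⟨?_, by simpa using e₁, by simp, by simp, by simp⟩
    repeat first
      | apply Building.setI _ (by norm_num) (by norm_num)
      | apply Building.setR _ (by norm_num) (by norm_num)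
    exact h₁
  rintro s₂ ⟨h₂, g10, g11, r2, r3⟩
  refine Runs.seq (Runs.loop (I := fun m s' => Building n a M lim l s' ∧ s'.ireg 10 = n ^ 2 ∧
    s'.ireg 11 = m ∧ s'.rreg 2 = ∑ i ∈ Finset.range m, (a i * a i + 1) ∧ s'.rreg 3 = 1)
    ?_ ?_ ⟨h₂, g10, g11, by simpa using r2, r3⟩) ?_
  · rintro m hm s ⟨h, g10, g11, r2, r3⟩
    refine ⟨by simpa [Test.Holds, g10, g11], Runs.block ?_⟩
    simp only [List.foldl, Instr.apply]
    refine ⟨?_, by simpa using g10, by simp [g11, h.ireg_two],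
      by simp [r2, r3, g11, h.rarr_zero, Finset.sum_range_succ], by simpa using r3⟩
    repeat first
      | apply Building.setI _ (by norm_num) (by norm_num)
      | apply Building.setR _ (by norm_num) (by norm_num)
    exact h
  · rintro s ⟨h, g10, g11, -, -⟩
    simp [Test.Holds, g10, g11]
  · rintro s ⟨h, -, -, r2, r3⟩
    refine Runs.block ?_
    simp only [List.foldl, Instr.apply]
    have h' := ((h.setR (r := 4) (v := (((2 * k ^ 2 : ℕ) : ℤ) : ℝ)) (by norm_num)
      (by norm_num)).setR (r := 4) (v := (((2 * k ^ 2 : ℕ) : ℤ) : ℝ) * entryBound n a)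
      (by norm_num) (by norm_num)).setWeight (bigWeight k n a)
    simpa [r2, r3, bigWeight, entryBound] using h'

/-- Write all points except for the origin. -/
def buildProg (k : ℕ) : Prog :=
  .seq (.block [.iconst 2 1]) (.seq (powProg 10 (k / 2 + 1))
    (.seq (.block [.iconst 11 0, .iconst 12 0]) (.seq tableLoop (.seq (weightProg k)
      (.seqs ((digitPairs k).map (pairProg k)))))))

/-- A constant for the running time of `buildProg`. -/
def buildConst (k : ℕ) : ℕ := 10 * k + (digitPairs k).length * (30 * k + 150) + 80

theorem runs_buildProg {k : ℕ} (hk : 2 ≤ k) {n : ℕ} (hn : 1 ≤ n) (w : Fin n → Fin n → ℝ) :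
    Runs (buildProg k) (cliqueInput w) (buildConst k * n ^ (k / 2 + 1)) fun s' =>
      Building n ((cliqueInput w).rarr 0) (bigWeight k n ((cliqueInput w).rarr 0))
        (n ^ (k / 2 + 1))
        (reductionPoints k n ((cliqueInput w).rarr 0) (bigWeight k n ((cliqueInput w).rarr 0)))
        s' := by
  set a := (cliqueInput w).rarr 0 with ha
  have hnD : n ≤ n ^ (k / 2 + 1) := Nat.le_self_pow (by omega) n
  -- Bounding the entries reads the whole matrix; `2 ≤ k` keeps this within the time for writing the
  -- points.
  have hn2 : n ^ 2 ≤ n ^ (k / 2 + 1) := Nat.pow_le_pow_right hn (by omega)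
  have hD1 : 1 ≤ n ^ (k / 2 + 1) := Nat.one_le_pow _ _ hn
  refine (Runs.seq (T₁ := 2) (R := fun s' => Building n a 0 0 [] s')
    (Runs.block (building_cliqueInput w)) fun s h =>
    Runs.seq (runs_powProg h (by norm_num) (by norm_num) _) fun s ⟨h, e, _, _⟩ =>
    Runs.seq (T₁ := 3) (R := fun s' => Building n a 0 0 [] s' ∧ s'.ireg 10 = n ^ (k / 2 + 1) ∧
      s'.ireg 11 = 0 ∧ s'.ireg 12 = 0) (Runs.block ?_) fun s ⟨h, h10, h11, h12⟩ =>
    Runs.seq (runs_tableLoop hn h h10 h11 h12) fun s h =>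
    Runs.seq (runs_weightProg k h) fun s h =>
    runs_seqs (digitPairs k) (pairProg k) (pairPoints k n a (bigWeight k n a)) _
      (fun x hx l s h => runs_pairProg hn x hx h) h).mono ?_ ?_
  · unfold buildConst
    set Y := n ^ (k / 2 + 1)
    have b1 : (k / 2 + 1) * (4 * n + 6) ≤ 10 * k * Y :=
      calc (k / 2 + 1) * (4 * n + 6) ≤ k * (10 * Y) := Nat.mul_le_mul (by omega) (by omega)
        _ = _ := by ring
    have b2 : (10 * k + (digitPairs k).length * (30 * k + 150) + 80) * Y =
      10 * k * Y + (digitPairs k).length * ((30 * k + 150) * Y) + 80 * Y := by ring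
    rw [b2]
    omega
  · intro s' h'
    simpa [reductionPoints] using h'
  · simp only [List.foldl, Instr.apply]
    exact ⟨(h.setI (by norm_num) (by norm_num)).setI (by norm_num) (by norm_num),
      by simpa using e, by simp, by simp⟩

/-! ### The heavy origin, the call of the given algorithm and the read-out -/

open Classical in
/-- Total weight of the points of a list in a box. -/
noncomputable def boxSum (lo hi : ℝ × ℝ) (l : List WPoint) : ℝ :=
  (l.map fun p => if (p.1, p.2.1) ∈ Set.Icc lo hi then p.2.2 else 0).sum

theorem boxSum_append (lo hi : ℝ × ℝ) (l l' : List WPoint) :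
    boxSum lo hi (l ++ l') = boxSum lo hi l + boxSum lo hi l' := by
  simp [boxSum]

theorem boxWeight_eq_boxSum (lo hi : ℝ × ℝ) (l : List WPoint) :
    boxWeight (fun i : Fin l.length => ((l[i]).1, (l[i]).2.1)) (fun i => (l[i]).2.2) lo hi =
      boxSum lo hi l := by
  classical
  rw [boxWeight, Finset.sum_filter, boxSum, ← Fin.sum_univ_getElem]
  exact Fintype.sum_equiv (finCongr (by simp)) _ _ (fun i => by simp)

/-- Append the origin with a weight that exceeds all others together, and write the number of
points into the register `40`. -/
def originProg : Prog :=
  .seq (.block [.iadd 4 1 3, .rcast 10 1, .rmul 10 10 1, .radd 10 10 10, .rconst 11 1,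
    .radd 10 10 11]) (.seq (emitProg 0 0 10) (.block [.iadd 40 1 3]))

/-- The list with the heavy origin appended. -/
noncomputable def withOrigin (M : ℝ) (l : List WPoint) : List WPoint :=
  l ++ [(0, 0, (l.length * M + l.length * M) + 1)]

/-- What the last stage needs to know about the low part of the memory. -/
structure Scannable (M : ℝ) (l l' : List WPoint) (s : State) : Prop where
  i2 : s.ireg 2 = 1
  i4 : s.ireg 4 = l.length
  r0 : s.rreg 0 = 0
  r1 : s.rreg 1 = M
  xs : s.rarr 1 = attrArray (fun p => p.1) l'
  ys : s.rarr 2 = attrArray (fun p => p.2.1) l'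
  ws : s.rarr 3 = attrArray (fun p => p.2.2) l'

theorem runs_originProg {n : ℕ} {a : ℕ → ℝ} {M : ℝ} {lim : ℕ} {l : List WPoint} {s : State}
    (h : Building n a M lim l s) :
    Runs originProg s 17 fun s' => Scannable M l (withOrigin M l) s' ∧
      s'.high 40 = rectangleInput
        (fun i : Fin (withOrigin M l).length => (((withOrigin M l)[i]).1, ((withOrigin M l)[i]).2.1))
        (fun i => ((withOrigin M l)[i]).2.2) := by
  refine Runs.seq (T₁ := 7) (T₂ := 10) (R := fun s' => Building n a M lim l s' ∧
    s'.ireg 4 = l.length ∧ s'.rreg 10 = (l.length * M + l.length * M) + 1) (Runs.block ?_) ?_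
  · simp only [List.foldl, Instr.apply]
    refine ⟨?_, by simp [h.ireg_one, h.ireg_three], by simp [h.ireg_one, h.rreg_one]⟩
    repeat first
      | apply Building.setI _ (by norm_num) (by norm_num)
      | apply Building.setR _ (by norm_num) (by norm_num)
    exact h
  clear h s
  rintro s ⟨h, h4, hH⟩
  refine Runs.seq (T₁ := 8) (T₂ := 2) (runs_emitProg h _ _ _) ?_
  rintro s' ⟨h', hi, hr⟩
  rw [h.rreg_zero, hH] at h'
  change Building n a M lim (withOrigin M l) s' at h'
  refine Runs.block ?_
  simp only [List.foldl, Instr.apply]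
  refine ⟨⟨?_, ?_, ?_, ?_, ?_, ?_, ?_⟩, ?_⟩
  · simp [h'.ireg_two]
  · simp [hi 4 (by norm_num) (by norm_num), h4]
  · simp [h'.rreg_zero]
  · simp [h'.rreg_one]
  · simp [h'.rarr_xs]
  · simp [h'.rarr_ys]
  · simp [h'.rarr_ws]
  -- The memory from name `40` on must be exactly a fresh input, because the renamed algorithm sees
  -- nothing else. Register `40` plays the role of register `0`.
  · simp only [State.high, rectangleInput, State.mk.injEq]
    refine ⟨?_, ?_, ?_, ?_⟩
    · funext r
      by_cases e : r = 0
      · simp [e, h'.ireg_one, h'.ireg_three]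
      · simp [e, h'.ireg_high (r + 40) (by omega)]
    · funext r
      simp [h'.rreg_high (r + 40) (by omega)]
    · funext A
      simp [h'.iarr_high (A + 40) (by omega)]
    · funext A i
      match A with
      | 0 => simp [h'.rarr_xs', attrArray]
      | 1 => simp [h'.rarr_ys', attrArray]
      | 2 => simp [h'.rarr_ws', attrArray]
      | A + 3 => simp [h'.rarr_high (A + 3 + 40) (by omega)]

/-- Add up the weights of the points in the box found, and subtract `k` times the dominating
weight. -/
def scanProg (k : ℕ) : Prog :=
  .seq (.block [.iconst 10 0, .rconst 10 0])
    (.seq (.loop (.ilt 10 4) (.seq (.block [.rload 11 1 10, .rload 12 2 10, .rload 13 3 10])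
      (.seq (.branch (.rlt 11 40) .skip (.branch (.rlt 42 11) .skip (.branch (.rlt 12 41) .skip
        (.branch (.rlt 43 12) .skip (.block [.radd 10 10 13])))))
        (.block [.iadd 10 10 2]))))
    (.block [.rconst 11 (k : ℤ), .rmul 11 11 1, .rsub 0 10 11]))

/-- The given algorithm returns only corners, so the weight is recomputed. Register `4` was set
before the origin was appended, so the scan stops before the tail `t`. -/
theorem runs_scanProg (k : ℕ) {M : ℝ} {l t : List WPoint} {s : State}
    (h : Scannable M l (l ++ t) s) :
    Runs (scanProg k) s (3 + ((l.length * (1 + 12) + 1) + 4)) fun s' =>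
      s'.rreg 0 = boxSum (s.rreg 40, s.rreg 41) (s.rreg 42, s.rreg 43) l - k * M := by
  set lo : ℝ × ℝ := (s.rreg 40, s.rreg 41) with hlo
  set hi : ℝ × ℝ := (s.rreg 42, s.rreg 43) with hhi
  let J : State → Prop := fun s' => Scannable M l (l ++ t) s' ∧ s'.rreg 40 = lo.1 ∧
    s'.rreg 41 = lo.2 ∧ s'.rreg 42 = hi.1 ∧ s'.rreg 43 = hi.2
  have JI : ∀ s' r v, J s' → 5 ≤ r → J (s'.setI r v) := by
    rintro s' r v ⟨⟨h1, h2, h3, h4, h5, h6, h7⟩, h8⟩ hr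
    refine ⟨⟨?_, ?_, h3, h4, h5, h6, h7⟩, h8⟩
    · simp [show 2 ≠ r by omega, h1]
    · simp [show 4 ≠ r by omega, h2]
  have JR : ∀ s' r v, J s' → 2 ≤ r → r < 40 → J (s'.setR r v) := by
    rintro s' r v ⟨⟨h1, h2, h3, h4, h5, h6, h7⟩, h8, h9, h10, h11⟩ hr hr'
    refine ⟨⟨h1, h2, ?_, ?_, h5, h6, h7⟩, ?_, ?_, ?_, ?_⟩
    · simp [show 0 ≠ r by omega, h3]
    · simp [show 1 ≠ r by omega, h4]
    · simp [show 40 ≠ r by omega, h8]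
    · simp [show 41 ≠ r by omega, h9]
    · simp [show 42 ≠ r by omega, h10]
    · simp [show 43 ≠ r by omega, h11]
  have hJ : J s := ⟨h, rfl, rfl, rfl, rfl⟩
  refine Runs.seq (T₁ := 3) (R := fun s' => J s' ∧ s'.ireg 10 = 0 ∧ s'.rreg 10 = 0)
    (Runs.block ?_) ?_
  · simp only [List.foldl, Instr.apply]
    exact ⟨JR _ _ _ (JI _ _ _ hJ (by norm_num)) (by norm_num) (by norm_num), by simp, by simp⟩
  rintro s₁ ⟨hJ₁, hi₁, hr₁⟩
  refine Runs.seq (Runs.loop (I := fun j s' => J s' ∧ s'.ireg 10 = j ∧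
    s'.rreg 10 = boxSum lo hi (l.take j)) ?_ ?_ ⟨hJ₁, hi₁, by simpa [boxSum] using hr₁⟩) ?_
  · rintro j hj s ⟨hJ, h10, hacc⟩
    refine ⟨by simpa [Test.Holds, h10, hJ.1.i4], ?_⟩
    refine Runs.seq (T₁ := 4) (T₂ := 8) (R := fun s' => J s' ∧ s'.ireg 10 = j ∧
      s'.rreg 10 = boxSum lo hi (l.take j) ∧ s'.rreg 11 = l[j].1 ∧ s'.rreg 12 = l[j].2.1 ∧
      s'.rreg 13 = l[j].2.2) (Runs.block ?_) ?_
    · simp only [List.foldl, Instr.apply]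
      have hj' : j < l.length + t.length := by omega
      refine ⟨?_, by simpa using h10, by simpa using hacc, ?_, ?_, ?_⟩
      · iterate 3 apply JR _ _ _ _ (by norm_num) (by norm_num)
        exact hJ
      · simp [h10, hJ.1.xs, attrArray, hj', List.getElem_append_left hj]
      · simp [h10, hJ.1.ys, attrArray, hj', List.getElem_append_left hj]
      · simp [h10, hJ.1.ws, attrArray, hj', List.getElem_append_left hj]
    clear hJ h10 hacc s
    rintro s ⟨hJ, h10, hacc, hx, hy, hw⟩
    have hsucc : boxSum lo hi (l.take (j + 1)) =
        boxSum lo hi (l.take j) + boxSum lo hi [l[j]] := by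
      rw [← boxSum_append, List.take_concat_get' l j hj]
    have hmem : ((l[j].1, l[j].2.1) ∈ Set.Icc lo hi) ↔
        ¬ l[j].1 < lo.1 ∧ ¬ hi.1 < l[j].1 ∧ ¬ l[j].2.1 < lo.2 ∧ ¬ hi.2 < l[j].2.1 := by
      simp only [Set.mem_Icc, Prod.le_def, not_lt]
      tauto
    have hout : (l[j].1, l[j].2.1) ∉ Set.Icc lo hi →
        boxSum lo hi (l.take (j + 1)) = boxSum lo hi (l.take j) := by
      intro hn
      rw [hsucc]
      simp only [boxSum, List.map_cons, List.map_nil, List.sum_cons, List.sum_nil, if_neg hn]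
      simp
    refine Runs.seq (T₁ := 6) (T₂ := 2) (R := fun s' => J s' ∧ s'.ireg 10 = j ∧
      s'.rreg 10 = boxSum lo hi (l.take (j + 1))) ?_ ?_
    · have hskip : ∀ T, 1 ≤ T → (l[j].1, l[j].2.1) ∉ Set.Icc lo hi →
          Runs .skip s T fun s' => J s' ∧ s'.ireg 10 = j ∧
            s'.rreg 10 = boxSum lo hi (l.take (j + 1)) := fun T hT hn =>
        (Runs.skip ⟨hJ, h10, by rw [hacc, hout hn]⟩).mono hT (fun _ => id)
      refine Runs.branch (T := 5) (fun hc => hskip _ (by norm_num) ?_) fun hc1 =>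
        Runs.branch (T := 4) (fun hc => hskip _ (by norm_num) ?_) fun hc2 =>
        Runs.branch (T := 3) (fun hc => hskip _ (by norm_num) ?_) fun hc3 =>
        Runs.branch (T := 2) (fun hc => hskip _ (by norm_num) ?_) fun hc4 => Runs.block ?_
      · simp only [Test.Holds, hx, hJ.2.1] at hc
        exact fun hm => (hmem.1 hm).1 hc
      · simp only [Test.Holds, hx, hJ.2.2.2.1] at hc
        exact fun hm => (hmem.1 hm).2.1 hc
      · simp only [Test.Holds, hy, hJ.2.2.1] at hc
        exact fun hm => (hmem.1 hm).2.2.1 hc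
      · simp only [Test.Holds, hy, hJ.2.2.2.2] at hc
        exact fun hm => (hmem.1 hm).2.2.2 hc
      · simp only [List.foldl, Instr.apply]
        refine ⟨JR _ _ _ hJ (by norm_num) (by norm_num), by simpa using h10, ?_⟩
        simp only [Test.Holds, hx, hy, hJ.2.1, hJ.2.2.1, hJ.2.2.2.1, hJ.2.2.2.2] at hc1 hc2 hc3 hc4
        have hm := hmem.2 ⟨hc1, hc2, hc3, hc4⟩
        rw [hsucc]
        simp only [State.setR_rreg, if_true, hacc, hw]
        simp only [boxSum, List.map_cons, List.map_nil, List.sum_cons, List.sum_nil, if_pos hm]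
        simp
    · rintro s' ⟨g1, g2, g3⟩
      refine Runs.block ?_
      simp only [List.foldl, Instr.apply]
      exact ⟨JI _ _ _ g1 (by norm_num), by simp [g2, g1.1.i2], by simpa using g3⟩
  · rintro s ⟨hJ, h10, -⟩
    simp [Test.Holds, h10, hJ.1.i4]
  · rintro s ⟨hJ, h10, hacc⟩
    refine Runs.block ?_
    simp only [List.foldl, Instr.apply]
    simp [hacc, hJ.1.r1]

/-- The algorithm for Max-Weight `k`-Clique obtained from an algorithm `P` for Max-Weight
Rectangle. -/
def cliqueProg (k : ℕ) (P : Prog) : Prog :=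
  .seq (buildProg k) (.seq originProg (.seq (P.shift 40) (scanProg k)))

theorem runs_cliqueProg {k : ℕ} (hk : 2 ≤ k) {P : Prog} {T : ℕ → ℕ}
    (hP : SolvesMaxWeightRectangle P T) {n : ℕ} (hn : 1 ≤ n) (w : Fin n → Fin n → ℝ) (M : ℝ)
    (hM : M = bigWeight k n ((cliqueInput w).rarr 0)) (l : List WPoint)
    (hl : l = reductionPoints k n ((cliqueInput w).rarr 0) M) :
    Runs (cliqueProg k P) (cliqueInput w)
      (buildConst k * n ^ (k / 2 + 1) + (17 + (T (l.length + 1) +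
        (3 + ((l.length * (1 + 12) + 1) + 4))))) fun s' =>
      ∃ lo hi : ℝ × ℝ, lo ≤ hi ∧ s'.rreg 0 = boxSum lo hi l - k * M ∧
        ∀ lo' hi' : ℝ × ℝ, lo' ≤ hi' →
          boxSum lo' hi' (withOrigin M l) ≤ boxSum lo hi (withOrigin M l) := by
  refine Runs.seq (runs_buildProg hk hn w) fun s h => ?_
  rw [← hM, ← hl] at h
  refine Runs.seq (runs_originProg h) ?_
  rintro s₁ ⟨h₁, hin⟩
  obtain ⟨t, σ, hex, ht, hle, hmax⟩ := hP _ _ _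
  obtain ⟨s₂, hex₂, hhigh, hlow⟩ := hex.shift 40 s₁ hin
  refine Runs.seq (T₁ := T (l.length + 1)) (R := fun s' => s' = s₂)
    ⟨t, s₂, hex₂, by simpa [withOrigin] using ht, rfl⟩ ?_
  rintro s' rfl
  -- The called algorithm may destroy its own copy of the points, but the copy in the arrays `1` to
  -- `3` lies below `40` and survives.
  have h₂ : Scannable M l (withOrigin M l) s' := by
    obtain ⟨g1, g2, g3, g4, g5, g6, g7⟩ := h₁
    exact ⟨by rw [hlow.ireg _ (by norm_num), g1], by rw [hlow.ireg _ (by norm_num), g2],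
      by rw [hlow.rreg _ (by norm_num), g3], by rw [hlow.rreg _ (by norm_num), g4],
      by rw [hlow.rarr _ (by norm_num), g5], by rw [hlow.rarr _ (by norm_num), g6],
      by rw [hlow.rarr _ (by norm_num), g7]⟩
  have e : ∀ r, σ.rreg r = s'.rreg (r + 40) := by
    intro r
    rw [← hhigh]
    rfl
  simp only [e, boxWeight_eq_boxSum] at hle hmax
  exact (runs_scanProg k h₂).mono le_rfl fun s₃ hs₃ => ⟨_, _, hle, hs₃, hmax⟩

/-! ### The weight of a box around the origin -/

theorem boxSum_flatMap {ι : Type*} (lo hi : ℝ × ℝ) (L : List ι) (f : ι → List WPoint) :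
    boxSum lo hi (L.flatMap f) = (L.map fun x => boxSum lo hi (f x)).sum := by
  induction L with
  | nil => simp [boxSum]
  | cons x L ih => rw [List.flatMap_cons, boxSum_append, ih]; simp

theorem boxSum_flatMap_range (lo hi : ℝ × ℝ) (N : ℕ) (f : ℕ → List WPoint) :
    boxSum lo hi ((List.range N).flatMap f) = ∑ i ∈ Finset.range N, boxSum lo hi (f i) := by
  rw [boxSum_flatMap, Finset.sum_range, ← List.sum_ofFn, List.ofFn_eq_map]
  congr 1
  rw [← List.map_coe_finRange_eq_range, List.map_map]
  rfl

theorem boxSum_le {lo hi : ℝ × ℝ} {l : List WPoint} {M : ℝ} (hM : 0 ≤ M)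
    (h : ∀ p ∈ l, p.2.2 ≤ M) : boxSum lo hi l ≤ l.length * M := by
  rw [boxSum, ← nsmul_eq_mul]
  refine (List.sum_le_card_nsmul _ M ?_).trans (by simp)
  intro y hy
  obtain ⟨p, hp, rfl⟩ := List.mem_map.1 hy
  split_ifs
  · exact h p hp
  · exact hM

/-- How far an interval reaches on the negative (even `a`) or positive (odd `a`) half-axis. -/
noncomputable def extent (lo hi : ℝ) (a : ℕ) : ℝ := if a % 2 = 0 then -lo else hi

theorem extent_nonneg {lo hi : ℝ} (hlo : lo ≤ 0) (hhi : 0 ≤ hi) (a : ℕ) :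
    0 ≤ extent lo hi a := by
  unfold extent
  split_ifs <;> linarith

/-- The sign `(-1) ^ (a + 1)` places the grid on the half-axis that `extent` measures. The other end
of the interval imposes no condition, because the interval contains `0`. -/
theorem mem_interval_iff {lo hi : ℝ} (hlo : lo ≤ 0) (hhi : 0 ≤ hi) (a : ℕ) {A : ℝ} (hA : 0 < A)
    (α : ℕ) : (lo ≤ α * ((((-1) ^ (a + 1) : ℤ) : ℝ) / A) ∧
      α * ((((-1) ^ (a + 1) : ℤ) : ℝ) / A) ≤ hi) ↔ α ≤ ⌊extent lo hi a * A⌋₊ := by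
  have hα : (0 : ℝ) ≤ α / A := by positivity
  rw [Nat.le_floor_iff (mul_nonneg (extent_nonneg hlo hhi a) hA.le), ← div_le_iff₀ hA]
  unfold extent
  rcases Nat.mod_two_eq_zero_or_one a with h | h
  · have : (((-1) ^ (a + 1) : ℤ) : ℝ) = -1 := by
      rw [Odd.neg_one_pow (by rw [Nat.odd_iff]; omega)]; norm_num
    rw [this, if_pos h, show (α : ℝ) * (-1 / A) = -(α / A) by ring]
    constructor
    · rintro ⟨h1, -⟩; linarith
    · intro h1; exact ⟨by linarith, by linarith⟩
  · have : (((-1) ^ (a + 1) : ℤ) : ℝ) = 1 := by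
      rw [Even.neg_one_pow (by rw [Nat.even_iff]; omega)]; norm_num
    rw [this, if_neg (by omega), show (α : ℝ) * (1 / A) = α / A by ring]
    constructor
    · rintro ⟨-, h1⟩; exact h1
    · intro h1; exact ⟨by linarith, h1⟩

/-- A mixed second difference: `[α ≤ p] - [α + 1 ≤ p] = [α = p]`, and likewise for `β` and `q`; the
sum of the four points is the product of the two indicators times `g`. -/
theorem boxSum_quad {lo hi : ℝ × ℝ} {p q α β : ℕ} {X Y g : ℝ}
    (hx : ∀ α : ℕ, (lo.1 ≤ α * X ∧ α * X ≤ hi.1) ↔ α ≤ p)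
    (hy : ∀ β : ℕ, (lo.2 ≤ β * Y ∧ β * Y ≤ hi.2) ↔ β ≤ q) :
    boxSum lo hi (quad (α * X) X (β * Y) Y g) = if α = p ∧ β = q then g else 0 := by
  have hmem : ∀ α β : ℕ, ((α * X, β * Y) ∈ Set.Icc lo hi) ↔ (α ≤ p ∧ β ≤ q) := by
    intro α β
    rw [← hx, ← hy]
    simp only [Set.mem_Icc, Prod.le_def]
    tauto
  have e1 : (α : ℝ) * X + X = ((α + 1 : ℕ) : ℝ) * X := by push_cast; ring
  have e2 : (β : ℝ) * Y + Y = ((β + 1 : ℕ) : ℝ) * Y := by push_cast; ring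
  simp only [boxSum, quad, e1, e2, List.map_cons, List.map_nil, List.sum_cons, List.sum_nil, hmem]
  rcases lt_trichotomy α p with h1 | h1 | h1 <;> rcases lt_trichotomy β q with h2 | h2 | h2 <;>
    (split_ifs <;> first | omega | simp)

/-- Only the quadruple of the cell `(p, q)` survives, if the gadget has one. Sides that reach too
far (`p ≥ A`) collect nothing. -/
theorem boxSum_gadgetPoints {lo hi : ℝ × ℝ} {p q n A C : ℕ} {X Y D : ℝ} {m : ℕ → ℝ}
    (sparse : Bool)
    (hx : ∀ α : ℕ, (lo.1 ≤ α * X ∧ α * X ≤ hi.1) ↔ α ≤ p)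
    (hy : ∀ β : ℕ, (lo.2 ≤ β * Y ∧ β * Y ≤ hi.2) ↔ β ≤ q) :
    boxSum lo hi (gadgetPoints m n D X Y sparse A C) = if p < A then
      ∑ γ ∈ Finset.range C, (if prefixIdx sparse n p γ = q then entry m n D (p % n) (q % n) else 0)
      else 0 := by
  simp only [gadgetPoints, gadgetRow, boxSum_flatMap_range, boxSum_quad hx hy]
  split_ifs with h
  · rw [Finset.sum_eq_single p]
    · refine Finset.sum_congr rfl fun γ _ => ?_
      by_cases e : prefixIdx sparse n p γ = q
      · simp [e]
      · simp [e]
    · intro α _ hα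
      simp [hα]
    · intro hp
      exact absurd (Finset.mem_range.2 h) hp
  · refine Finset.sum_eq_zero fun α hα => Finset.sum_eq_zero fun γ _ => if_neg ?_
    rintro ⟨rfl, -⟩
    exact h (Finset.mem_range.1 hα)

/-- The prefix on the first axis that ends with the digit `a`. -/
noncomputable def fstPrefix (n : ℕ) (lo hi : ℝ × ℝ) (a : ℕ) : ℕ :=
  ⌊extent lo.1 hi.1 a * (n : ℝ) ^ fstDepth a⌋₊

/-- The prefix on the second axis that ends with the digit `b`. -/
noncomputable def sndPrefix (k n : ℕ) (lo hi : ℝ × ℝ) (b : ℕ) : ℕ :=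
  ⌊extent lo.2 hi.2 b * (n : ℝ) ^ sndDepth k b⌋₊

section

variable {k n : ℕ} {lo hi : ℝ × ℝ} {m : ℕ → ℝ} {M : ℝ}

/-- Here every second prefix occurs once, so the inner sum picks out `q` itself. -/
theorem boxSum_pairPoints_of_ne (hn : 1 ≤ n) (hlo : lo ≤ 0) (hhi : 0 ≤ hi) {a b : ℕ}
    (hab : a ≠ b) : boxSum lo hi (pairPoints k n m M (a, b)) =
      if fstPrefix n lo hi a < n ^ fstDepth a ∧ sndPrefix k n lo hi b < n ^ sndDepth k b then
        entry m n (-M) (fstPrefix n lo hi a % n) (sndPrefix k n lo hi b % n) else 0 := by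
  have hn0 : (0 : ℝ) < n := by exact_mod_cast hn
  rw [pairPoints, boxSum_gadgetPoints _ (mem_interval_iff hlo.1 hhi.1 a (pow_pos hn0 _))
    (mem_interval_iff hlo.2 hhi.2 b (pow_pos hn0 _))]
  change (if fstPrefix n lo hi a < _ then ∑ γ ∈ Finset.range _,
    (if prefixIdx _ n (fstPrefix n lo hi a) γ = sndPrefix k n lo hi b then
      entry m n _ (fstPrefix n lo hi a % n) (sndPrefix k n lo hi b % n) else 0) else 0) = _
  simp only [innerDepth, hab, decide_false, prefixIdx, Bool.false_eq_true, if_false,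
    Finset.sum_ite_eq', Finset.mem_range, ite_and]
  simp

/-- Here only second prefixes with the last digit of `p` occur, so the entry read is always the
diagonal value `M`: the gadget checks that the two copies of a digit agree. -/
theorem boxSum_pairPoints_self (hn : 1 ≤ n) (hlo : lo ≤ 0) (hhi : 0 ≤ hi) {b : ℕ} (hb : b < k) :
    boxSum lo hi (pairPoints k n m M (b, b)) =
      if fstPrefix n lo hi b < n ^ fstDepth b ∧ sndPrefix k n lo hi b < n ^ sndDepth k b ∧
        fstPrefix n lo hi b % n = sndPrefix k n lo hi b % n then M else 0 := by
  have hn0 : (0 : ℝ) < n := by exact_mod_cast hn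
  rw [pairPoints, boxSum_gadgetPoints _ (mem_interval_iff hlo.1 hhi.1 b (pow_pos hn0 _))
    (mem_interval_iff hlo.2 hhi.2 b (pow_pos hn0 _))]
  change (if fstPrefix n lo hi b < _ then ∑ γ ∈ Finset.range _,
    (if prefixIdx _ n (fstPrefix n lo hi b) γ = sndPrefix k n lo hi b then
      entry m n _ (fstPrefix n lo hi b % n) (sndPrefix k n lo hi b % n) else 0) else 0) = _
  rw [ite_and]
  refine if_congr Iff.rfl ?_ rfl
  generalize fstPrefix n lo hi b = p
  generalize sndPrefix k n lo hi b = q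
  simp only [innerDepth, decide_true, prefixIdx, if_true]
  have hd : n ^ sndDepth k b = n ^ (sndDepth k b - 1) * n := by
    rw [← pow_succ]
    congr 1
    unfold sndDepth
    omega
  have hp := Nat.mod_lt p hn
  split_ifs with h
  · obtain ⟨h1, h2⟩ := h
    -- Given its last digit, `q` is determined by the quotient `q / n`.
    rw [Finset.sum_eq_single (q / n)]
    · rw [if_pos (by rw [h2]; exact Nat.mod_add_div' q n), entry, if_pos h2]
      simp
    · intro γ _ hγ
      refine if_neg fun e => hγ ?_
      rw [← e, Nat.add_mul_div_right _ _ hn, Nat.div_eq_of_lt hp, zero_add]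
    · intro h3
      rw [hd] at h1
      exact absurd (Finset.mem_range.2 (Nat.div_lt_of_lt_mul (by rwa [mul_comm]))) h3
  · refine Finset.sum_eq_zero fun γ hγ => if_neg fun e => h ?_
    rw [Finset.mem_range] at hγ
    subst e
    constructor
    · rw [hd]
      calc p % n + γ * n < n + γ * n := by omega
        _ = (γ + 1) * n := by ring
        _ ≤ _ := Nat.mul_le_mul_right n hγ
    · simp

theorem boxSum_reductionPoints : boxSum lo hi (reductionPoints k n m M) =
    (∑ x ∈ (Finset.range k ×ˢ Finset.range k).filter (fun x => x.1 < x.2),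
      boxSum lo hi (pairPoints k n m M x)) +
    ∑ b ∈ Finset.range k, boxSum lo hi (pairPoints k n m M (b, b)) := by
  have h : reductionPoints k n m M = (List.range k).flatMap fun b =>
      (List.range (b + 1)).flatMap fun a => pairPoints k n m M (a, b) := by
    simp [reductionPoints, digitPairs, List.flatMap_assoc, List.flatMap_map]
  rw [h]
  simp only [boxSum_flatMap_range, Finset.sum_range_succ, Finset.sum_add_distrib]
  congr 1
  rw [Finset.sum_filter, Finset.sum_product_right]
  refine Finset.sum_congr rfl fun b hb => ?_
  rw [← Finset.sum_filter]
  refine Finset.sum_congr ?_ fun _ _ => rfl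
  ext a
  simp only [Finset.mem_range, Finset.mem_filter] at hb ⊢
  omega

end

/-! ### Cliques -/

/-- The sum over `offDiag` does not refer to the order. This allows passing from the order of
positions to that of vertices, as an enumeration of a clique need not be monotone. -/
theorem two_mul_sum_lt {ι : Type*} [LinearOrder ι] (I : Finset ι) (f : ι → ι → ℝ)
    (hf : ∀ i j, f i j = f j i) :
    2 * ∑ x ∈ (I ×ˢ I).filter (fun x => x.1 < x.2), f x.1 x.2 = ∑ x ∈ I.offDiag, f x.1 x.2 := by
  have h1 : ∑ x ∈ (I ×ˢ I).filter (fun x => x.1 < x.2), f x.1 x.2 =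
      ∑ x ∈ (I ×ˢ I).filter (fun x => x.2 < x.1), f x.1 x.2 := by
    refine Finset.sum_nbij' Prod.swap Prod.swap ?_ ?_ ?_ ?_ ?_
    · rintro ⟨a, b⟩; simp; tauto
    · rintro ⟨a, b⟩; simp; tauto
    · simp
    · simp
    · rintro ⟨a, b⟩ _; exact hf a b
  rw [two_mul]
  nth_rewrite 2 [h1]
  rw [← Finset.sum_union]
  · refine Finset.sum_congr ?_ fun _ _ => rfl
    ext ⟨a, b⟩
    simp only [Finset.mem_union, Finset.mem_filter, Finset.mem_product, Finset.mem_offDiag,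
      ne_iff_lt_or_gt]
    tauto
  · rw [Finset.disjoint_filter]
    rintro ⟨a, b⟩ _ h
    exact h.not_gt

/-- The sum over the pairs of positions of an enumeration of a clique is its weight. -/
theorem sum_pairs_eq_cliqueWeight {n k : ℕ} (w : Fin n → Fin n → ℝ) (hw : ∀ i j, w i j = w j i)
    (z : ℕ → Fin n) (hz : Set.InjOn z (Finset.range k)) :
    ∑ x ∈ (Finset.range k ×ˢ Finset.range k).filter (fun x => x.1 < x.2), w (z x.1) (z x.2) =
      cliqueWeight w ((Finset.range k).image z) := by
  have h1 := two_mul_sum_lt (Finset.range k) (fun a b => w (z a) (z b)) (fun _ _ => hw _ _)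
  have h2 := two_mul_sum_lt ((Finset.range k).image z) w hw
  have h3 : ∑ x ∈ (Finset.range k).offDiag, w (z x.1) (z x.2) =
      ∑ x ∈ ((Finset.range k).image z).offDiag, w x.1 x.2 := by
    refine Finset.sum_nbij (fun x => (z x.1, z x.2)) ?_ ?_ ?_ ?_
    · rintro ⟨a, b⟩ h
      rw [Finset.mem_offDiag] at h ⊢
      exact ⟨Finset.mem_image_of_mem z h.1, Finset.mem_image_of_mem z h.2.1,
        fun e => h.2.2 (hz h.1 h.2.1 e)⟩
    · rintro ⟨a, b⟩ h ⟨c, d⟩ h' e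
      rw [Finset.mem_coe, Finset.mem_offDiag] at h h'
      rw [Prod.mk.injEq] at e ⊢
      exact ⟨hz h.1 h'.1 e.1, hz h.2.1 h'.2.1 e.2⟩
    · rintro ⟨u, v⟩ h
      rw [Finset.mem_coe, Finset.mem_offDiag] at h
      obtain ⟨h1, h2, h3⟩ := h
      obtain ⟨a, ha, rfl⟩ := Finset.mem_image.1 h1
      obtain ⟨b, hb, rfl⟩ := Finset.mem_image.1 h2
      exact ⟨(a, b), Finset.mem_coe.2 (Finset.mem_offDiag.2 ⟨ha, hb, fun e => h3 (congrArg z e)⟩),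
        rfl⟩
    · intro x _; rfl
  have h4 : cliqueWeight w ((Finset.range k).image z) =
      ∑ x ∈ (((Finset.range k).image z) ×ˢ ((Finset.range k).image z)).filter
        (fun x => x.1 < x.2), w x.1 x.2 := by
    simp only [cliqueWeight]
    rw [Finset.sum_filter, Finset.sum_product]
    simp only [Finset.sum_filter]
  rw [h4]
  linarith

/-! ### Digits -/

/-- Digit `1` is the most significant one, so dividing by `n ^ (p - j)` leaves the prefix of length
`j`. The induction appends a last digit. -/
theorem exists_nat_digits {n : ℕ} (d : ℕ → ℕ) (hd : ∀ j, d j < n) (p : ℕ) :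
    ∃ A < n ^ p, ∀ j, 1 ≤ j → j ≤ p → A / n ^ (p - j) % n = d j := by
  induction p with
  | zero => exact ⟨0, by simp, by omega⟩
  | succ p ih =>
    obtain ⟨A, hA, h⟩ := ih
    have hn : 0 < n := (Nat.zero_le _).trans_lt (hd 0)
    have hp := hd (p + 1)
    refine ⟨A * n + d (p + 1), ?_, fun j h1 h2 => ?_⟩
    · calc A * n + d (p + 1) < A * n + n := by omega
        _ = (A + 1) * n := by ring
        _ ≤ n ^ p * n := Nat.mul_le_mul_right n hA
        _ = _ := (pow_succ _ _).symm
    · rcases Nat.lt_or_ge p j with h3 | h3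
      · obtain rfl : j = p + 1 := by omega
        simp [Nat.mod_eq_of_lt hp]
      · rw [show p + 1 - j = (p - j) + 1 by omega, pow_succ', ← Nat.div_div_eq_div_mul,
          show A * n + d (p + 1) = d (p + 1) + A * n by ring, Nat.add_mul_div_right _ _ hn,
          Nat.div_eq_of_lt hp, zero_add]
        exact h j h1 h3

/-- The number `A / n ^ p` in `[0, 1)` has all its prefixes of length `j ≤ p` as floors after
scaling by `n ^ j`. -/
theorem exists_real_digits {n : ℕ} (d : ℕ → ℕ) (hd : ∀ j, d j < n) (p : ℕ) :
    ∃ u : ℝ, 0 ≤ u ∧ ∀ j, 1 ≤ j → j ≤ p →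
      ⌊u * (n : ℝ) ^ j⌋₊ < n ^ j ∧ ⌊u * (n : ℝ) ^ j⌋₊ % n = d j := by
  obtain ⟨A, hA, h⟩ := exists_nat_digits d hd p
  have hn : (0 : ℝ) < n := by exact_mod_cast (Nat.zero_le _).trans_lt (hd 0)
  refine ⟨A / (n : ℝ) ^ p, by positivity, fun j h1 h2 => ?_⟩
  have e : (A : ℝ) / (n : ℝ) ^ p * (n : ℝ) ^ j = (A : ℝ) / ((n ^ (p - j) : ℕ) : ℝ) := by
    have : (n : ℝ) ^ p = (n : ℝ) ^ (p - j) * (n : ℝ) ^ j := by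
      rw [← pow_add]; congr 1; omega
    rw [this]
    push_cast
    field_simp
  rw [e, Nat.floor_div_eq_div]
  refine ⟨Nat.div_lt_of_lt_mul ?_, h j h1 h2⟩
  rw [← pow_add, show p - j + j = p by omega]
  exact hA

/-- Every sequence of digits is realized by a box around the origin. -/
theorem exists_box {k n : ℕ} (z : ℕ → ℕ) (hz : ∀ a, z a < n) :
    ∃ lo hi : ℝ × ℝ, lo ≤ 0 ∧ 0 ≤ hi ∧ ∀ a < k,
      (fstPrefix n lo hi a < n ^ fstDepth a ∧ fstPrefix n lo hi a % n = z a) ∧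
      (sndPrefix k n lo hi a < n ^ sndDepth k a ∧ sndPrefix k n lo hi a % n = z a) := by
  -- On the first axis, depth `j` of the side of parity `r` belongs to the digit `2 (j - 1) + r`.
  have hu : ∀ r : ℕ, _ := fun r => exists_real_digits (fun j => z (2 * (j - 1) + r))
    (fun j => hz _) k
  -- On the second axis depth `j` belongs to the indices `k + 1 - 2 j` and `k - 2 j`; the parity `r`
  -- selects one of them.
  have hv : ∀ r : ℕ, _ := fun r => exists_real_digits
    (fun j => z (if (k + 1 - 2 * j) % 2 = r then k + 1 - 2 * j else k - 2 * j)) (fun j => hz _) k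
  choose u hu0 hu using hu
  choose v hv0 hv using hv
  have hext : ∀ (f : ℕ → ℝ) (a : ℕ), extent (-f 0) (f 1) a = f (a % 2) := by
    intro f a
    unfold extent
    rcases Nat.mod_two_eq_zero_or_one a with h | h <;> simp [h]
  refine ⟨(-u 0, -v 0), (u 1, v 1), ⟨by simpa using hu0 0, by simpa using hv0 0⟩,
    ⟨hu0 1, hv0 1⟩, fun a ha => ?_⟩
  have h1 := hu (a % 2) (fstDepth a) (by unfold fstDepth; omega) (by unfold fstDepth; omega)
  have h2 := hv (a % 2) (sndDepth k a) (by unfold sndDepth; omega) (by unfold sndDepth; omega)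
  have e1 : 2 * (fstDepth a - 1) + a % 2 = a := by unfold fstDepth; omega
  have e2 : (if (k + 1 - 2 * sndDepth k a) % 2 = a % 2 then k + 1 - 2 * sndDepth k a
      else k - 2 * sndDepth k a) = a := by
    unfold sndDepth
    split_ifs <;> omega
  rw [e1] at h1
  rw [e2] at h2
  simp only [fstPrefix, sndPrefix, hext]
  exact ⟨h1, h2⟩

/-! ### From optimal boxes to maximum cliques -/

section

variable {k n : ℕ} (w : Fin n → Fin n → ℝ)

theorem cliqueInput_entry (u v : Fin n) : (cliqueInput w).rarr 0 (u * n + v) = w u v := by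
  have hn : 0 < n := u.pos
  have h : (u : ℕ) * n + v < n * n := by
    calc (u : ℕ) * n + v < u * n + n := by omega
      _ = (u + 1) * n := by ring
      _ ≤ _ := Nat.mul_le_mul_right n u.isLt
  have e1 : ((u : ℕ) * n + v) / n = u := by
    rw [add_comm, Nat.add_mul_div_right _ _ hn, Nat.div_eq_of_lt v.isLt, zero_add]
  have e2 : ((u : ℕ) * n + v) % n = v := by
    rw [add_comm, Nat.add_mul_mod_self_right, Nat.mod_eq_of_lt v.isLt]
  simp only [cliqueInput, h, and_self, dif_pos]
  congr 1 <;> simp [e1, e2]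

theorem entryBound_nonneg (m : ℕ → ℝ) : 0 ≤ entryBound n m :=
  Finset.sum_nonneg fun i _ => by nlinarith [mul_self_nonneg (m i)]

/-- One summand suffices, since `x ^ 2 + 1 ≥ 2 |x|`. -/
theorem abs_le_entryBound {m : ℕ → ℝ} {u v : ℕ} (hu : u < n) (hv : v < n) :
    |m (u * n + v)| ≤ entryBound n m := by
  have h : u * n + v < n ^ 2 := by
    calc u * n + v < u * n + n := by omega
      _ = (u + 1) * n := by ring
      _ ≤ n * n := Nat.mul_le_mul_right n hu
      _ = _ := (sq n).symm
  refine le_trans ?_ (Finset.single_le_sum (f := fun i => m i * m i + 1)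
    (fun i _ => by nlinarith [mul_self_nonneg (m i)]) (Finset.mem_range.2 h))
  rw [abs_le]
  constructor <;> nlinarith [sq_nonneg (m (u * n + v) - 1), sq_nonneg (m (u * n + v) + 1)]

theorem bigWeight_eq (m : ℕ → ℝ) : bigWeight k n m = 2 * (k : ℝ) ^ 2 * entryBound n m + 1 := by
  simp [bigWeight]

theorem entryBound_le_bigWeight (hk : 1 ≤ k) (m : ℕ → ℝ) :
    entryBound n m ≤ bigWeight k n m := by
  have h := entryBound_nonneg (n := n) m
  have hk' : (1 : ℝ) ≤ (k : ℝ) ^ 2 := one_le_pow₀ (by exact_mod_cast hk)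
  rw [bigWeight_eq]
  nlinarith

/-- Bounds the weight of a box that misses the origin by the number of points times `M`. -/
theorem reductionPoints_weight_le (hk : 1 ≤ k) (hn : 1 ≤ n) (m : ℕ → ℝ) :
    ∀ p ∈ reductionPoints k n m (bigWeight k n m), p.2.2 ≤ bigWeight k n m := by
  have hB := entryBound_nonneg (n := n) m
  have hM := entryBound_le_bigWeight (n := n) hk m
  have key : ∀ (κ : ℤ), (κ = 1 ∨ κ = -1) → ∀ u v : ℕ, u < n → v < n →
      |entry m n ((κ : ℝ) * bigWeight k n m) u v| ≤ bigWeight k n m := by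
    intro κ hκ u v hu hv
    unfold entry
    split_ifs
    · rcases hκ with rfl | rfl <;> simp [abs_of_nonneg (hB.trans hM)]
    · exact (abs_le_entryBound hu hv).trans hM
  intro p hp
  obtain ⟨x, -, hp⟩ := List.mem_flatMap.1 hp
  obtain ⟨α, -, hp⟩ := List.mem_flatMap.1 hp
  obtain ⟨γ, -, hp⟩ := List.mem_flatMap.1 hp
  have h := key (if x.1 = x.2 then 1 else -1) (by split_ifs <;> simp) (α % n)
    (prefixIdx (decide (x.1 = x.2)) n α γ % n) (Nat.mod_lt _ hn) (Nat.mod_lt _ hn)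
  rw [abs_le] at h
  simp only [quad, List.mem_cons, List.not_mem_nil, or_false] at hp
  rcases hp with rfl | rfl | rfl | rfl
  · exact h.2
  · simp only; linarith [h.1]
  · simp only; linarith [h.1]
  · exact h.2

theorem card_pairs_le (k : ℕ) :
    (((Finset.range k ×ˢ Finset.range k).filter (fun x => x.1 < x.2)).card : ℝ) ≤ (k : ℝ) ^ 2 := by
  have := Finset.card_filter_le (Finset.range k ×ˢ Finset.range k) (fun x => x.1 < x.2)
  rw [Finset.card_product, Finset.card_range] at this
  rw [sq]
  exact_mod_cast this

theorem neg_le_sum_pairs (z : ℕ → Fin n) :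
    -((k : ℝ) ^ 2 * entryBound n ((cliqueInput w).rarr 0)) ≤
      ∑ x ∈ (Finset.range k ×ˢ Finset.range k).filter (fun x => x.1 < x.2),
        w (z x.1) (z x.2) := by
  set B := entryBound n ((cliqueInput w).rarr 0) with hB
  have h0 : 0 ≤ B := entryBound_nonneg _
  refine le_trans ?_ (Finset.card_nsmul_le_sum _ _ (-B) ?_)
  · rw [nsmul_eq_mul]
    nlinarith [card_pairs_le k]
  · intro x _
    rw [← cliqueInput_entry w]
    exact (abs_le.1 (abs_le_entryBound (z x.1).isLt (z x.2).isLt)).1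

/-- Writing the same digits on both axes passes all `k` checks, and by injectivity no pair meets the
diagonal penalty. -/
theorem exists_box_of_clique (hn : 1 ≤ n) (z : ℕ → Fin n) (hz : Set.InjOn z (Finset.range k))
    (M : ℝ) : ∃ lo hi : ℝ × ℝ, lo ≤ 0 ∧ 0 ≤ hi ∧
      boxSum lo hi (reductionPoints k n ((cliqueInput w).rarr 0) M) =
        k * M + ∑ x ∈ (Finset.range k ×ˢ Finset.range k).filter (fun x => x.1 < x.2),
          w (z x.1) (z x.2) := by
  obtain ⟨lo, hi, hlo, hhi, h⟩ := exists_box (k := k) (fun a => (z a : ℕ)) (fun a => (z a).isLt)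
  refine ⟨lo, hi, hlo, hhi, ?_⟩
  rw [boxSum_reductionPoints, add_comm]
  congr 1
  · rw [Finset.sum_congr rfl (g := fun _ => M)]
    · simp
    · intro b hb
      obtain ⟨⟨h1, h2⟩, h3, h4⟩ := h b (Finset.mem_range.1 hb)
      rw [boxSum_pairPoints_self hn hlo hhi (Finset.mem_range.1 hb),
        if_pos ⟨h1, h3, by rw [h2, h4]⟩]
  · refine Finset.sum_congr rfl ?_
    rintro ⟨a, b⟩ hab
    simp only [Finset.mem_filter, Finset.mem_product, Finset.mem_range] at hab
    obtain ⟨⟨ha, hb⟩, hlt⟩ := hab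
    obtain ⟨⟨h1, h2⟩, -⟩ := h a ha
    obtain ⟨-, h3, h4⟩ := h b hb
    rw [boxSum_pairPoints_of_ne hn hlo hhi hlt.ne, if_pos ⟨h1, h3⟩, h2, h4, entry, if_neg,
      cliqueInput_entry]
    intro e
    exact hlt.ne (hz (by simpa using ha) (by simpa using hb) (Fin.ext e))

/-- A box around the origin either encodes a clique or is light. -/
theorem clique_or_boxSum_le (hk : 1 ≤ k) (hn : 1 ≤ n) {lo hi : ℝ × ℝ} (hlo : lo ≤ 0)
    (hhi : 0 ≤ hi) {B M : ℝ} (hB : B = entryBound n ((cliqueInput w).rarr 0))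
    (hM : M = bigWeight k n ((cliqueInput w).rarr 0)) :
    (∃ z : ℕ → Fin n, Set.InjOn z (Finset.range k) ∧
      boxSum lo hi (reductionPoints k n ((cliqueInput w).rarr 0) M) =
        k * M + ∑ x ∈ (Finset.range k ×ˢ Finset.range k).filter (fun x => x.1 < x.2),
          w (z x.1) (z x.2)) ∨
    boxSum lo hi (reductionPoints k n ((cliqueInput w).rarr 0) M) ≤
      k * M - M + (k : ℝ) ^ 2 * B := by
  have hB0 : 0 ≤ B := hB ▸ entryBound_nonneg _
  have hBM : B ≤ M := by rw [hB, hM]; exact entryBound_le_bigWeight hk _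
  have hM0 : 0 ≤ M := hB0.trans hBM
  set m := (cliqueInput w).rarr 0 with hm
  set P := (Finset.range k ×ˢ Finset.range k).filter (fun x => x.1 < x.2) with hP
  have hcard : (P.card : ℝ) * B ≤ (k : ℝ) ^ 2 * B :=
    mul_le_mul_of_nonneg_right (card_pairs_le k) hB0
  have hE : ∀ x ∈ P, boxSum lo hi (pairPoints k n m M x) ≤ B := by
    rintro ⟨a, b⟩ hx
    have hlt : a < b := (Finset.mem_filter.1 hx).2
    rw [boxSum_pairPoints_of_ne hn hlo hhi hlt.ne]
    split_ifs
    · unfold entry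
      split_ifs
      · linarith
      · rw [hB]
        exact (abs_le.1 (abs_le_entryBound (Nat.mod_lt _ hn) (Nat.mod_lt _ hn))).2
    · exact hB0
  have hD : ∀ b ∈ Finset.range k, boxSum lo hi (pairPoints k n m M (b, b)) ≤ M := by
    intro b hb
    rw [boxSum_pairPoints_self hn hlo hhi (Finset.mem_range.1 hb)]
    split_ifs
    · exact le_rfl
    · exact hM0
  rw [boxSum_reductionPoints]
  by_cases hcheck : ∀ b ∈ Finset.range k, fstPrefix n lo hi b < n ^ fstDepth b ∧
      sndPrefix k n lo hi b < n ^ sndDepth k b ∧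
        fstPrefix n lo hi b % n = sndPrefix k n lo hi b % n
  · have hDsum : ∑ b ∈ Finset.range k, boxSum lo hi (pairPoints k n m M (b, b)) = k * M := by
      rw [Finset.sum_congr rfl (g := fun _ => M)]
      · simp
      · intro b hb
        rw [boxSum_pairPoints_self hn hlo hhi (Finset.mem_range.1 hb), if_pos (hcheck b hb)]
    rw [hDsum]
    let z : ℕ → Fin n := fun b => ⟨fstPrefix n lo hi b % n, Nat.mod_lt _ hn⟩
    have hEz : ∀ x ∈ P, boxSum lo hi (pairPoints k n m M x) =
        entry m n (-M) (z x.1) (z x.2) := by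
      rintro ⟨a, b⟩ hx
      have hlt : a < b := (Finset.mem_filter.1 hx).2
      obtain ⟨ha, hb⟩ := Finset.mem_product.1 (Finset.mem_filter.1 hx).1
      rw [boxSum_pairPoints_of_ne hn hlo hhi hlt.ne,
        if_pos ⟨(hcheck a ha).1, (hcheck b hb).2.1⟩, ← (hcheck b hb).2.2]
    by_cases hz : Set.InjOn z (Finset.range k)
    · left
      refine ⟨z, hz, ?_⟩
      rw [add_comm]
      congr 1
      refine Finset.sum_congr rfl ?_
      rintro ⟨a, b⟩ hx
      have hlt : a < b := (Finset.mem_filter.1 hx).2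
      obtain ⟨ha, hb⟩ := Finset.mem_product.1 (Finset.mem_filter.1 hx).1
      rw [hEz _ hx, entry, if_neg, hm, cliqueInput_entry]
      intro e
      exact hlt.ne (hz ha hb (Fin.ext e))
    · right
      -- A repeated vertex: the gadget of this pair contributes `-M`, every other pair at most `B`.
      obtain ⟨x₀, hx₀, he⟩ : ∃ x₀ ∈ P, z x₀.1 = z x₀.2 := by
        unfold Set.InjOn at hz
        push Not at hz
        obtain ⟨a, ha, b, hb, he, hne⟩ := hz
        rcases hne.lt_or_gt with h | h
        · exact ⟨(a, b), Finset.mem_filter.2 ⟨Finset.mem_product.2 ⟨ha, hb⟩, h⟩, he⟩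
        · exact ⟨(b, a), Finset.mem_filter.2 ⟨Finset.mem_product.2 ⟨hb, ha⟩, h⟩, he.symm⟩
      have : ∑ x ∈ P, boxSum lo hi (pairPoints k n m M x) ≤
          ∑ x ∈ P, (B - if x = x₀ then M else 0) := by
        refine Finset.sum_le_sum fun x hx => ?_
        split_ifs with e
        · subst e
          rw [hEz _ hx, entry, if_pos (by rw [he])]
          linarith
        · simpa using hE x hx
      rw [Finset.sum_sub_distrib, Finset.sum_ite_eq' P x₀, if_pos hx₀, Finset.sum_const,
        nsmul_eq_mul] at this
      linarith
  · right
    -- A failed check forfeits one of the `k` rewards `M`.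
    push Not at hcheck
    obtain ⟨b₀, hb₀, hno⟩ := hcheck
    have h1 : ∑ b ∈ Finset.range k, boxSum lo hi (pairPoints k n m M (b, b)) ≤
        ∑ b ∈ Finset.range k, (M - if b = b₀ then M else 0) := by
      refine Finset.sum_le_sum fun b hb => ?_
      split_ifs with e
      · subst e
        rw [boxSum_pairPoints_self hn hlo hhi (Finset.mem_range.1 hb), if_neg]
        · linarith
        · rintro ⟨h1, h2, h3⟩
          exact hno h1 h2 h3
      · simpa using hD b hb
    rw [Finset.sum_sub_distrib, Finset.sum_ite_eq' (Finset.range k) b₀, if_pos hb₀,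
      Finset.sum_const, nsmul_eq_mul, Finset.card_range] at h1
    have h2 := Finset.sum_le_card_nsmul P _ B hE
    rw [nsmul_eq_mul] at h2
    linarith

theorem exists_enumeration (hn : 1 ≤ n) {S : Finset (Fin n)} (hS : S.card = k) :
    ∃ z : ℕ → Fin n, Set.InjOn z (Finset.range k) ∧ (Finset.range k).image z = S := by
  refine ⟨fun i => if h : i < k then S.orderEmbOfFin hS ⟨i, h⟩ else ⟨0, hn⟩, ?_, ?_⟩
  · intro i hi j hj e
    rw [Finset.mem_coe, Finset.mem_range] at hi hj
    simpa [hi, hj] using e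
  · ext v
    simp only [Finset.mem_image, Finset.mem_range]
    constructor
    · rintro ⟨i, hi, rfl⟩
      simp [hi]
    · intro hv
      have : v ∈ Set.range (S.orderEmbOfFin hS) := by rwa [Finset.range_orderEmbOfFin]
      obtain ⟨i, rfl⟩ := this
      exact ⟨i, i.isLt, by simp⟩

theorem isNClique_top_iff {S : Finset (Fin n)} :
    (⊤ : SimpleGraph (Fin n)).IsNClique k S ↔ S.card = k := by
  rw [SimpleGraph.isNClique_iff]
  exact ⟨fun h => h.2, fun h => ⟨fun _ _ _ _ hne => hne, h⟩⟩

theorem boxSum_withOrigin_of_mem {lo hi : ℝ × ℝ} (hlo : lo ≤ 0) (hhi : 0 ≤ hi) (M : ℝ)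
    (l : List WPoint) : boxSum lo hi (withOrigin M l) =
      boxSum lo hi l + ((l.length * M + l.length * M) + 1) := by
  have h : ((0, 0) : ℝ × ℝ) ∈ Set.Icc lo hi := ⟨hlo, hhi⟩
  rw [withOrigin, boxSum_append]
  congr 1
  simp only [boxSum, List.map_cons, List.map_nil, List.sum_cons, List.sum_nil, if_pos h]
  simp

theorem boxSum_withOrigin_of_notMem {lo hi : ℝ × ℝ} (h : ¬ (lo ≤ 0 ∧ 0 ≤ hi)) (M : ℝ)
    (l : List WPoint) : boxSum lo hi (withOrigin M l) = boxSum lo hi l := by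
  have h' : ((0, 0) : ℝ × ℝ) ∉ Set.Icc lo hi := h
  rw [withOrigin, boxSum_append]
  simp only [boxSum, List.map_cons, List.map_nil, List.sum_cons, List.sum_nil, if_neg h']
  simp

/-- A box of maximum weight yields the maximum weight of a `k`-clique. -/
theorem isGreatest_of_isMax (hk : 1 ≤ k) (hkn : k ≤ n) (hw : ∀ i j, w i j = w j i) {M : ℝ}
    (hM : M = bigWeight k n ((cliqueInput w).rarr 0)) {l : List WPoint}
    (hl : l = reductionPoints k n ((cliqueInput w).rarr 0) M) {lo hi : ℝ × ℝ}
    (hmax : ∀ lo' hi' : ℝ × ℝ, lo' ≤ hi' →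
      boxSum lo' hi' (withOrigin M l) ≤ boxSum lo hi (withOrigin M l)) :
    IsGreatest (cliqueWeight w '' {S | (⊤ : SimpleGraph (Fin n)).IsNClique k S})
      (boxSum lo hi l - k * M) := by
  have hn : 1 ≤ n := hk.trans hkn
  set B := entryBound n ((cliqueInput w).rarr 0) with hB
  have hB0 : 0 ≤ B := entryBound_nonneg _
  have hMB : M = 2 * (k : ℝ) ^ 2 * B + 1 := by rw [hM, bigWeight_eq]
  have hk2 : 0 ≤ (k : ℝ) ^ 2 * B := by positivity
  have hM0 : 0 ≤ M := by rw [hMB]; positivity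
  have hlow : ∀ S : Finset (Fin n), S.card = k → -((k : ℝ) ^ 2 * B) ≤ cliqueWeight w S ∧
      ∃ lo hi : ℝ × ℝ, lo ≤ 0 ∧ 0 ≤ hi ∧ boxSum lo hi l = k * M + cliqueWeight w S := by
    intro S hS
    obtain ⟨z, hz, rfl⟩ := exists_enumeration hn hS
    rw [← sum_pairs_eq_cliqueWeight w hw z hz, hl]
    exact ⟨neg_le_sum_pairs w z, exists_box_of_clique w hn z hz M⟩
  obtain ⟨S₀, -, hS₀⟩ : ∃ S ⊆ (Finset.univ : Finset (Fin n)), S.card = k :=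
    Finset.exists_subset_card_eq (by simpa using hkn)
  obtain ⟨hc₀, lo₀, hi₀, hlo₀, hhi₀, e₀⟩ := hlow S₀ hS₀
  -- The box of any clique has weight at least `k M - k² B ≥ 0` before the origin is added, hence
  -- more than twice the number of points times `M` with it; a box without the origin cannot
  -- compete.
  have hmem : lo ≤ 0 ∧ 0 ≤ hi := by
    by_contra hno
    have h1 := hmax lo₀ hi₀ (hlo₀.trans hhi₀)
    rw [boxSum_withOrigin_of_mem hlo₀ hhi₀, boxSum_withOrigin_of_notMem hno, e₀] at h1
    have h2 : boxSum lo hi l ≤ l.length * M := boxSum_le hM0 (by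
      rw [hl, hM]
      exact reductionPoints_weight_le hk hn _)
    have h3 : (0 : ℝ) ≤ l.length * M := by positivity
    have h4 : M ≤ k * M := le_mul_of_one_le_left hM0 (by exact_mod_cast hk)
    linarith
  have hbest : ∀ S : Finset (Fin n), S.card = k → k * M + cliqueWeight w S ≤ boxSum lo hi l := by
    intro S hS
    obtain ⟨-, lo', hi', hlo', hhi', e⟩ := hlow S hS
    have h1 := hmax lo' hi' (hlo'.trans hhi')
    rw [boxSum_withOrigin_of_mem hlo' hhi', boxSum_withOrigin_of_mem hmem.1 hmem.2, e] at h1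
    linarith
  constructor
  · rcases clique_or_boxSum_le w hk hn hmem.1 hmem.2 hB hM with ⟨z, hz, e⟩ | h
    · refine ⟨(Finset.range k).image z, isNClique_top_iff.2 ?_, ?_⟩
      · rw [Finset.card_image_of_injOn hz, Finset.card_range]
      · rw [hl, e, sum_pairs_eq_cliqueWeight w hw z hz]
        ring
    -- A light box would weigh at most `k M - M + k² B < k M - k² B`, less than the box of any
    -- clique.
    · rw [← hl] at h
      linarith [hbest S₀ hS₀]
  · rintro _ ⟨S, hS, rfl⟩
    linarith [hbest S (isNClique_top_iff.1 hS)]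

end

/-! ### Running time -/

/-- The running time of `cliqueProg`. -/
def cliqueTime (k : ℕ) (T : ℕ → ℕ) (n : ℕ) : ℕ :=
  buildConst k * n ^ (k / 2 + 1) + (17 + (T (numPoints k n + 1) +
    (3 + ((numPoints k n * (1 + 12) + 1) + 4))))

theorem solvesMaxWeightClique_cliqueProg {k : ℕ} (hk : 2 ≤ k) {P : Prog} {T : ℕ → ℕ}
    (hP : SolvesMaxWeightRectangle P T) :
    SolvesMaxWeightClique k (cliqueProg k P) (cliqueTime k T) := by
  intro n w hkn hw
  obtain ⟨t, s, hex, ht, lo, hi, -, hs, hmax⟩ := runs_cliqueProg hk hP (by omega) w _ rfl _ rfl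
  rw [reductionPoints_length] at ht
  refine ⟨t, s, hex, ht, ?_⟩
  rw [hs]
  exact isGreatest_of_isMax w (by omega) hkn hw rfl rfl hmax

/-- The call costs `n ^ ((k / 2 + 1) (2 - ε))`, and `k ε ≥ 4` turns this exponent into at most `k -
ε`. Building and scanning cost `n ^ (k / 2 + 1)`, where `k / 2 + 1 ≤ k - ε` follows from `k ≥ 4` and
`ε ≤ 1`. -/
theorem cliqueTime_isBigO {ε : ℝ} (hε1 : ε ≤ 1) {k : ℕ} (hk : 4 ≤ k)
    (hkε : 4 ≤ k * ε) {T : ℕ → ℕ}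
    (hT : (fun N : ℕ => (T N : ℝ)) =O[atTop] fun N : ℕ => (N : ℝ) ^ (2 - ε)) :
    (fun n : ℕ => (cliqueTime k T n : ℝ)) =O[atTop] fun n : ℕ => (n : ℝ) ^ ((k : ℝ) - ε) := by
  have hk4 : (4 : ℝ) ≤ k := by exact_mod_cast hk
  have hD : ((k / 2 + 1 : ℕ) : ℝ) ≤ k / 2 + 1 := by
    push_cast
    gcongr
    exact Nat.cast_div_le
  have hpow : ∀ e : ℝ, e ≤ k - ε → (fun n : ℕ => (n : ℝ) ^ e) =O[atTop]
      fun n : ℕ => (n : ℝ) ^ ((k : ℝ) - ε) := by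
    intro e he
    refine IsBigO.of_bound 1 ?_
    filter_upwards [eventually_ge_atTop 1] with n hn
    rw [one_mul, Real.norm_of_nonneg (by positivity), Real.norm_of_nonneg (by positivity)]
    exact Real.rpow_le_rpow_of_exponent_le (by exact_mod_cast hn) he
  have hY : (fun n : ℕ => ((n ^ (k / 2 + 1) : ℕ) : ℝ)) =O[atTop]
      fun n : ℕ => (n : ℝ) ^ ((k : ℝ) - ε) := by
    refine (hpow ((k / 2 + 1 : ℕ) : ℝ) (by linarith)).congr_left fun n => ?_
    rw [Real.rpow_natCast]
    push_cast
    rfl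
  have hone : ∀ c : ℝ, (fun _ : ℕ => c) =O[atTop] fun n : ℕ => (n : ℝ) ^ ((k : ℝ) - ε) := by
    intro c
    have := (hpow 0 (by linarith)).const_mul_left c
    simpa using this
  set C : ℝ := (digitPairs k).length * 4 + 1 with hC
  have hC0 : 0 ≤ C := by positivity
  have hNle : ∀ n : ℕ, 1 ≤ n → ((numPoints k n + 1 : ℕ) : ℝ) ≤ C * (n : ℝ) ^ (k / 2 + 1) := by
    intro n hn
    have h1 : ((numPoints k n : ℕ) : ℝ) ≤ (digitPairs k).length * (4 * (n : ℝ) ^ (k / 2 + 1)) := by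
      exact_mod_cast numPoints_le k hn
    have h2 : (1 : ℝ) ≤ (n : ℝ) ^ (k / 2 + 1) := one_le_pow₀ (by exact_mod_cast hn)
    push_cast
    rw [hC]
    linarith
  have hN : (fun n : ℕ => (numPoints k n : ℝ)) =O[atTop]
      fun n : ℕ => (n : ℝ) ^ ((k : ℝ) - ε) := by
    refine IsBigO.trans (IsBigO.of_bound C ?_) hY
    filter_upwards [eventually_ge_atTop 1] with n hn
    have h1 := hNle n hn
    push_cast at h1 ⊢
    rw [Real.norm_of_nonneg (by positivity), Real.norm_of_nonneg (by positivity)]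
    linarith
  -- The bound on `T` holds only for large arguments.
  have htend : Tendsto (fun n => numPoints k n + 1) atTop atTop := by
    refine tendsto_atTop_mono' _ ?_ tendsto_id
    filter_upwards [eventually_ge_atTop 1] with n hn
    exact (le_numPoints (by omega) hn).trans (Nat.le_succ _)
  have hTN : (fun n : ℕ => (T (numPoints k n + 1) : ℝ)) =O[atTop]
      fun n : ℕ => (n : ℝ) ^ ((k : ℝ) - ε) := by
    refine (hT.comp_tendsto htend).trans ?_
    refine IsBigO.trans (IsBigO.of_bound (C ^ (2 - ε)) ?_)
      (hpow (((k / 2 + 1 : ℕ) : ℝ) * (2 - ε)) ?_)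
    · filter_upwards [eventually_ge_atTop 1] with n hn
      simp only [Function.comp_apply]
      rw [Real.norm_of_nonneg (by positivity), Real.norm_of_nonneg (by positivity),
        Real.rpow_mul (Nat.cast_nonneg n), Real.rpow_natCast,
        ← Real.mul_rpow hC0 (by positivity)]
      exact Real.rpow_le_rpow (by positivity) (hNle n hn) (by linarith)
    · calc ((k / 2 + 1 : ℕ) : ℝ) * (2 - ε) ≤ (k / 2 + 1) * (2 - ε) :=
            mul_le_mul_of_nonneg_right hD (by linarith)
        _ ≤ k - ε := by nlinarith
  have hsum := (hY.const_mul_left (buildConst k : ℝ)).add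
    ((hone 17).add (hTN.add ((hone 3).add (((hN.const_mul_left 13).add (hone 1)).add (hone 4)))))
  refine hsum.congr_left fun n => ?_
  simp only [cliqueTime]
  push_cast
  ring

/-- Reading the input already takes linear time. -/
theorem SolvesMaxWeightRectangle.exponent_le {P : Prog} {T : ℕ → ℕ}
    (hP : SolvesMaxWeightRectangle P T) {ε : ℝ}
    (hT : (fun N : ℕ => (T N : ℝ)) =O[atTop] fun N : ℕ => (N : ℝ) ^ (2 - ε)) : ε ≤ 1 := by
  by_contra! hε
  have h1 : (fun N : ℕ => (N : ℝ)) =O[atTop] fun N : ℕ => (N : ℝ) ^ (2 - ε) := by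
    refine IsBigO.trans (IsBigO.of_bound 1 (Eventually.of_forall fun N => ?_)) hT
    simpa using hP.le_time N
  obtain ⟨C, hC⟩ := h1.bound
  have htend : Tendsto (fun N : ℕ => (N : ℝ) ^ (ε - 1)) atTop atTop :=
    (tendsto_rpow_atTop (sub_pos.2 hε)).comp tendsto_natCast_atTop_atTop
  obtain ⟨N, hN, hN1, hNC⟩ := (hC.and ((eventually_ge_atTop 1).and
    (htend.eventually_gt_atTop C))).exists
  have hN0 : (0 : ℝ) < N := by exact_mod_cast hN1
  rw [Real.norm_of_nonneg hN0.le, Real.norm_of_nonneg (by positivity)] at hN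
  have h2 : (N : ℝ) ^ (ε - 1) * (N : ℝ) ^ (2 - ε) = N := by
    rw [← Real.rpow_add hN0, show ε - 1 + (2 - ε) = 1 by ring, Real.rpow_one]
  have h3 := mul_lt_mul_of_pos_right hNC (Real.rpow_pos_of_pos hN0 (2 - ε))
  linarith

theorem mainTheorem2 (ε : ℝ) (hε : 0 < ε)
    (hrect : ∃ (P : RealRAM.Prog) (T : ℕ → ℕ), SolvesMaxWeightRectangle P T ∧
      (fun N : ℕ => (T N : ℝ)) =O[atTop] (fun N : ℕ => (N : ℝ) ^ (2 - ε))) :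
    ∃ (Q : RealRAM.Prog) (T : ℕ → ℕ), SolvesMaxWeightClique ⌈4 / ε⌉₊ Q T ∧
      (fun n : ℕ => (T n : ℝ)) =O[atTop] (fun n : ℕ => (n : ℝ) ^ ((⌈4 / ε⌉₊ : ℝ) - ε)) := by
  obtain ⟨P, T, hP, hT⟩ := hrect
  -- This also gives `⌈4 / ε⌉₊ ≥ 4`; for `ε > 1` the hypothesis cannot be satisfied.
  have hε1 := hP.exponent_le hT
  have hceil : 4 / ε ≤ (⌈4 / ε⌉₊ : ℝ) := Nat.le_ceil _
  have hkε : 4 ≤ (⌈4 / ε⌉₊ : ℝ) * ε := (div_le_iff₀ hε).1 hceil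
  have hk : 4 ≤ ⌈4 / ε⌉₊ := by
    have : (4 : ℝ) ≤ 4 / ε := by rw [le_div_iff₀ hε]; linarith
    exact_mod_cast this.trans hceil
  exact ⟨cliqueProg _ P, cliqueTime _ T, solvesMaxWeightClique_cliqueProg (by omega) hP,
    cliqueTime_isBigO hε1 hk hkε hT⟩
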